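/- Let $\mathbf{Top}$ be the category of topological spaces and continuous maps. A \emph{triangle} is the convex hull of three affinely independent points of the Euclidean plane, with the Euclidean metric. A \emph{continuous family of (non-oriented) triangles} over a space $X$ is a proper continuous map $p:\mathcal F\to X$ (closed with compact fibers) which is a locally trivial fiber bundle, together with a continuous map $d:\mathcal F\times_X\mathcal F\to\mathbb R_{\ge 0}$ whose restriction to $\mathcal F_x\times\mathcal F_x$ is, for every $x\in X$, a metric on the fiber $\mathcal F_x$ making it isometric to a triangle. Let $\mathcal N$ be the category whose objects are the continuous families of triangles $\mathcal F\to X$ over all spaces $X$, and whose morphisms from $\mathcal F'\to X'$ to $\mathcal F\to X$ are the commutative squares of continuous maps $\mathcal F'\to\mathcal F$, $f:X'\to X$ such that $\mathcal F'\to\mathcal F$ restricts to a (bijective) isometry $\mathcal F'_{x'}\to\mathcal F_{f(x')}$ for every $x'\in X'$. It is a category over $\mathbf{Top}$ by $(\mathcal F\to X)\mapsto X$. Let $$M=\{(m_1,m_2,m_3)\in\mathbb R^3 : m_1,m_2,m_3>0,\ m_1<m_2+m_3,\ m_2<m_1+m_3,\ m_3<m_1+m_2\}$$ with the subspace topology;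 $m_i$ is the length of the edge opposite to the $i$-th vertex of a triangle with labelled vertices. The discrete group $S_3$ acts on $M$ from the left by permuting the labels of the vertices: $(\sigma\cdot m)_i=m_{\sigma^{-1}(i)}$. For a topological group $G$, a principal $G$-bundle over $Y$ is a continuous map $E\to Y$ from a space with a continuous right $G$-action preserving the fibers, which is locally over $Y$ equivariantly homeomorphic to $U\times G\to U$ (so $E=\emptyset$ is allowed if $Y=\emptyset$). For a left $G$-space $Z$, the quotient stack $[Z/G]$ is the following category over $\mathbf{Top}$. Its objects are the principal $G$-bundles $E\to Y$ over all spaces $Y$ with a continuous map $\varphi:E\to Z$ such that $\varphi(e\cdot g)=g^{-1}\cdot\varphi(e)$. Its morphisms are the cartesian squares with $G$-equivariant upper map $E'\to E$ over $Y'\to Y$ such that the composite $E'\to E\to Z$ is the given map $E'\to Z$. It lies over $\mathbf{Top}$ by $(E\to Y)\mapsto Y$. \textbf{Theorem.} $\mathcal N$ and $[M/S_3]$ are categories fibered in groupoids over $\mathbf{Top}$, and they are equivalent as categories over $\mathbf{Top}$: there are functors $H:\mathcal N\to[M/S_3]$ and $K:[M/S_3]\to\mathcal N$ commuting with the projections to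 $\mathbf{Top}$, and natural isomorphisms $K\circ H\cong\mathrm{id}$ and $H\circ K\cong\mathrm{id}$ lying over identities of $\mathbf{Top}$. -/

import Mathlib

open CategoryTheory

universe u

/-! ### Categories fibered in groupoids -/

/-- A functor `p : 𝒳 ⥤ 𝒮` is a category fibered in groupoids over `𝒮` (a groupoid fibration) if it
is a fibered category all of whose fibers are groupoids. -/
structure IsGroupoidFibration {𝒮 𝒳 : Type*} [Category 𝒮] [Category 𝒳] (p : 𝒳 ⥤ 𝒮) : Prop where
  isFibered : p.IsFibered
  isIso_fiber : ∀ (S : 𝒮) {a b : p.Fiber S} (φ : a ⟶ b), IsIso φ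

/-! ### Continuous families of (non-oriented) triangles -/

/-- A continuous family of triangles: a proper map `proj : total ⟶ base` which is a fiber bundle,
with a continuous distance map on `total ×_base total` that makes every fiber isometric to a
(nondegenerate, filled) triangle of the Euclidean plane. In particular the distance map is
nonnegative and restricts to a metric on every fiber. -/
structure TriangleFamily : Type (u + 1) where
  base : TopCat.{u}
  total : TopCat.{u}
  proj : total ⟶ base
  isProper : IsProperMap proj
  isFiberBundle : ∃ (T : Type u) (_ : TopologicalSpace T),
    ∀ x : base, ∃ t : Bundle.Trivialization T proj, x ∈ t.baseSet
  dist : {q : total × total // proj q.1 = proj q.2} → ℝ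
  continuous_dist : Continuous dist
  isTriangle : ∀ x : base, ∃ (Δ : Affine.Triangle ℝ (EuclideanSpace ℝ (Fin 2)))
    (e : {a : total // proj a = x} ≃ Δ.closedInterior),
    ∀ a b : {a : total // proj a = x},
      dist ⟨(a.1, b.1), a.2.trans b.2.symm⟩ = Dist.dist (e a) (e b)

namespace TriangleFamily

/-- A morphism of families of triangles: a commutative square whose upper map restricts to
(bijective) isometries of the fibers. -/
@[ext]
structure Hom (F F' : TriangleFamily.{u}) : Type u where
  base : F.base ⟶ F'.base
  total : F.total ⟶ F'.total
  comm : ∀ a, F'.proj (total a) = base (F.proj a)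
  bijOn : ∀ x, Set.BijOn total {a | F.proj a = x} {a | F'.proj a = base x}
  isometry : ∀ (a b : F.total) (h : F.proj a = F.proj b),
    F'.dist ⟨(total a, total b), by rw [comm, comm, h]⟩ = F.dist ⟨(a, b), h⟩

instance : Category TriangleFamily.{u} where
  Hom := Hom
  id F :=
    { base := 𝟙 _
      total := 𝟙 _
      comm := fun _ => rfl
      bijOn := fun _ => Set.bijOn_id _
      isometry := fun _ _ _ => rfl }
  comp f g :=
    { base := f.base ≫ g.base
      total := f.total ≫ g.total
      comm := fun a => by simp [f.comm, g.comm]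
      bijOn := fun x => (g.bijOn (f.base x)).comp (f.bijOn x)
      isometry := fun a b h =>
        (g.isometry (f.total a) (f.total b) (by rw [f.comm, f.comm, h])).trans
          (f.isometry a b h) }

/-- The projection sending a family of triangles to its base space. -/
def toTop : TriangleFamily.{u} ⥤ TopCat.{u} where
  obj F := F.base
  map f := f.base

end TriangleFamily

/-- The category of continuous families of non-oriented triangles, as a category over `Top`. -/
def triangleFamilies : BasedCategory.{u, u + 1} TopCat.{u} :=
  BasedCategory.ofFunctor TriangleFamily.toTop.{u}

/-! ### Principal bundles and quotient stacks -/

/-- A principal `G`-bundle `proj : total ⟶ base`, where `G` acts on the right of `total` (that is,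
`Gᵐᵒᵖ` acts on the left). The local trivializations `proj ⁻¹' U ≃ U × G` are equivariant for right
multiplication; in particular `base` is the quotient of `total` by `G`. The empty bundle over the
empty space is allowed. -/
structure PrincipalBundle (G : Type) [Group G] [TopologicalSpace G] : Type (u + 1) where
  base : TopCat.{u}
  total : TopCat.{u}
  proj : total ⟶ base
  [mulAction : MulAction Gᵐᵒᵖ total]
  [continuousSMul : ContinuousSMul Gᵐᵒᵖ total]
  proj_smul : ∀ (g : G) (e : total), proj (MulOpposite.op g • e) = proj e
  locallyTrivial : ∀ y : base, ∃ t : Bundle.Trivialization G proj, y ∈ t.baseSet ∧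
    ∀ e ∈ t.source, ∀ g : G, (t (MulOpposite.op g • e)).2 = (t e).2 * g

attribute [instance] PrincipalBundle.mulAction PrincipalBundle.continuousSMul

/-- An object of the quotient stack `[X/G]` of a left `G`-space `X`: a principal `G`-bundle with an
equivariant map to `X`, where `X` carries the right action `x · g = g⁻¹ • x`. -/
structure QuotientStack (G X : Type) [Group G] [TopologicalSpace G] [IsTopologicalGroup G]
    [TopologicalSpace X] [MulAction G X] [ContinuousSMul G X] : Type (u + 1)
    extends PrincipalBundle.{u} G where
  toSpace : C(total, X)
  toSpace_smul : ∀ (g : G) (e : total), toSpace (MulOpposite.op g • e) = g⁻¹ • toSpace e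

namespace QuotientStack

variable {G X : Type} [Group G] [TopologicalSpace G] [IsTopologicalGroup G]
  [TopologicalSpace X] [MulAction G X] [ContinuousSMul G X]

/-- A morphism in `[X/G]`: a cartesian square whose upper map is equivariant and compatible with the
maps to `X`. -/
@[ext]
structure Hom (P Q : QuotientStack.{u} G X) : Type u where
  base : P.base ⟶ Q.base
  total : P.total ⟶ Q.total
  isPullback : IsPullback total P.proj Q.proj base
  map_smul : ∀ (g : G) (e : P.total), total (MulOpposite.op g • e) = MulOpposite.op g • total e
  toSpace_comp : ∀ e, Q.toSpace (total e) = P.toSpace e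

instance : Category (QuotientStack.{u} G X) where
  Hom := Hom
  id P :=
    { base := 𝟙 _
      total := 𝟙 _
      isPullback := IsPullback.of_id_fst
      map_smul := fun _ _ => rfl
      toSpace_comp := fun _ => rfl }
  comp f g :=
    { base := f.base ≫ g.base
      total := f.total ≫ g.total
      isPullback := f.isPullback.paste_horiz g.isPullback
      map_smul := fun k e => by simp [f.map_smul, g.map_smul]
      toSpace_comp := fun e => by simp [f.toSpace_comp, g.toSpace_comp] }

variable (G X) in
/-- The projection sending a principal bundle to its base space. -/
def toTop : QuotientStack.{u} G X ⥤ TopCat.{u} where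
  obj P := P.base
  map f := f.base

end QuotientStack

/-- The quotient stack `[X/G]`, as a category over `Top`. -/
def quotientStack (G X : Type) [Group G] [TopologicalSpace G] [IsTopologicalGroup G]
    [TopologicalSpace X] [MulAction G X] [ContinuousSMul G X] :
    BasedCategory.{u, u + 1} TopCat.{u} :=
  BasedCategory.ofFunctor (QuotientStack.toTop.{u} G X)

/-! ### The moduli space of oriented triangles -/

/-- The open cone of oriented triangles in `ℝ³`. The coordinate `m i` is the length of the edge
opposite to the vertex labelled `i`. -/
def OrientedModuli : Type :=
  {m : Fin 3 → ℝ // (0 < m 0 ∧ m 0 < m 1 + m 2) ∧ (0 < m 1 ∧ m 1 < m 0 + m 2) ∧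
    (0 < m 2 ∧ m 2 < m 0 + m 1)}

namespace OrientedModuli

instance : TopologicalSpace OrientedModuli :=
  inferInstanceAs (TopologicalSpace (Subtype _))

/-- The symmetric group `S₃` with the discrete topology. -/
instance : TopologicalSpace (Equiv.Perm (Fin 3)) := ⊥

instance : DiscreteTopology (Equiv.Perm (Fin 3)) := ⟨rfl⟩

theorem perm_mem (σ : Equiv.Perm (Fin 3)) (m : OrientedModuli) :
    (0 < m.1 (σ 0) ∧ m.1 (σ 0) < m.1 (σ 1) + m.1 (σ 2)) ∧
    (0 < m.1 (σ 1) ∧ m.1 (σ 1) < m.1 (σ 0) + m.1 (σ 2)) ∧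
    (0 < m.1 (σ 2) ∧ m.1 (σ 2) < m.1 (σ 0) + m.1 (σ 1)) := by
  obtain ⟨m, ⟨h1, h2⟩, ⟨h3, h4⟩, h5, h6⟩ := m
  have h01 : σ 0 ≠ σ 1 := fun h => absurd (σ.injective h) (by decide)
  have h02 : σ 0 ≠ σ 2 := fun h => absurd (σ.injective h) (by decide)
  have h12 : σ 1 ≠ σ 2 := fun h => absurd (σ.injective h) (by decide)
  generalize σ 0 = a at *
  generalize σ 1 = b at *
  generalize σ 2 = c at *
  fin_cases a <;> fin_cases b <;> fin_cases c <;>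
    first
      | exact absurd rfl h01
      | exact absurd rfl h02
      | exact absurd rfl h12
      | (dsimp at *; refine ⟨⟨?_, ?_⟩, ⟨?_, ?_⟩, ?_, ?_⟩ <;> linarith)

/-- The symmetric group acts by permuting the labels of the vertices. -/
instance : MulAction (Equiv.Perm (Fin 3)) OrientedModuli where
  smul σ m := ⟨fun i => m.1 (σ⁻¹ i), perm_mem σ⁻¹ m⟩
  one_smul _ := rfl
  mul_smul σ τ m := by
    apply Subtype.ext
    funext i
    change m.1 ((σ * τ)⁻¹ i) = m.1 (τ⁻¹ (σ⁻¹ i))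
    rw [mul_inv_rev, Equiv.Perm.mul_apply]

instance : ContinuousSMul (Equiv.Perm (Fin 3)) OrientedModuli where
  continuous_smul := by
    refine continuous_prod_of_discrete_left.mpr fun σ => ?_
    have h : Continuous fun m : OrientedModuli => m.1 := continuous_subtype_val
    exact Continuous.subtype_mk
      (continuous_pi fun i => (continuous_apply (σ⁻¹ i)).comp h) fun m => perm_mem σ⁻¹ m

end OrientedModuli

/-! The functor from families to `[M/S₃]` replaces a family by the bundle of labellings of its
vertices, with the edge lengths as map to `M`. For this to be continuous in the family, vertices
must be recognized from the metric alone. Heron's formula expresses the squared area of three points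
through their distances, and a triple in a fiber consists of the three vertices exactly when its
area is maximal: in barycentric coordinates the area is scaled by the absolute value of a
determinant (`heronSq_sqDist`), which is at most one, with equality only at permutations of the
vertices (`exists_perm_of_one_le_det_sq`).

Maximality survives limits, because a competing triple can be spread to nearby fibers by a local
trivialization (`isVertices_of_tendsto`). Hence the space of labellings is proper over the base. It
is also separated, and `S₃` acts simply transitively on its fibers; for a finite discrete group this
already gives a principal bundle (`exists_equivariant_trivialization`).

The functor is fully faithful because a point of a triangle is determined by its distances to the
vertices. A morphism of vertex bundles preserves edge lengths, so it extends to the fibers by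
matching these distances; properness makes the extension continuous (`continuous_of_corresponds`).

For essential surjectivity, a bundle `E` with a map to `M` yields the associated bundle of simplices
`E ×_{S₃} Δ²`. Its squared distance is the quadratic form `sqDist` in barycentric coordinates, which
is invariant under relabelling. `E` maps equivariantly, over the identity, to the vertex bundle of
this family, and such a map is an isomorphism.

The quotient stack is fibered in groupoids because bundles pull back and all its morphisms are
cartesian squares. The families inherit the property through the fully faithful functor, so they
need no pullback construction of their own. No separation axiom is imposed on the bases; limits are
therefore compared only within a fiber, along ultrafilters. -/

/-! ### Equivalences of categories over a base -/

namespace CategoryTheory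

section

variable {𝒮 𝒳 : Type*} [Category 𝒮] [Category 𝒳]

/-- A category over `𝒮` is fibered in groupoids if all its morphisms are strongly cartesian and
every morphism of the base lifts. -/
theorem isGroupoidFibration_of_isStronglyCartesian {p : 𝒳 ⥤ 𝒮}
    (hlift : ∀ (a : 𝒳) (R : 𝒮) (f : R ⟶ p.obj a), ∃ (b : 𝒳) (φ : b ⟶ a), p.IsHomLift f φ)
    (hcart : ∀ {a b : 𝒳} (φ : a ⟶ b), p.IsStronglyCartesian (p.map φ) φ) :
    IsGroupoidFibration p := by
  have key : ∀ {a b : 𝒳} (φ : a ⟶ b) {R S : 𝒮} (f : R ⟶ S), p.IsHomLift f φ →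
      p.IsStronglyCartesian f φ := by
    rintro a b φ R S f ⟨⟩
    exact hcart φ
  constructor
  · refine Functor.IsFibered.of_exists_isStronglyCartesian fun a R f => ?_
    obtain ⟨b, φ, hφ⟩ := hlift a R f
    exact ⟨b, φ, key φ f hφ⟩
  · rintro S a b ⟨φ, hφ⟩
    have hc : p.IsStronglyCartesian (𝟙 S) φ := key φ _ hφ
    have hi : IsIso φ := Functor.IsStronglyCartesian.isIso_of_base_isIso p (𝟙 S) φ
    refine ⟨⟨inv φ, IsHomLift.lift_id_inv_isIso p S φ⟩, ?_, ?_⟩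
    · exact Subtype.ext (IsIso.hom_inv_id φ)
    · exact Subtype.ext (IsIso.inv_hom_id φ)

end

namespace BasedFunctor

variable {𝒮 : Type*} [Category 𝒮]

section

variable {𝒳 𝒴 : BasedCategory 𝒮} (H : BasedFunctor 𝒳 𝒴)

/-- A category over `𝒮` that embeds fully faithfully, with essential image everything up to
isomorphisms over identities, into a category fibered in groupoids is fibered in groupoids. -/
theorem isGroupoidFibration_of_fullyFaithful [H.toFunctor.Full] [H.toFunctor.Faithful]
    (hH : ∀ b : 𝒴.obj, ∃ (a : 𝒳.obj) (e : H.obj a ≅ b), 𝒴.p.IsHomLift (𝟙 (𝒴.p.obj b)) e.hom)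
    (h𝒴 : IsGroupoidFibration 𝒴.p) : IsGroupoidFibration 𝒳.p where
  isFibered := Functor.IsFibered.of_exists_isStronglyCartesian fun a R f => by
    have := h𝒴.isFibered
    obtain ⟨b, φ, hφ⟩ := IsPreFibered.exists_isCartesian 𝒴.p (H.w_obj a) f
    -- The source of the cartesian lift is replaced by an isomorphic object in the image of `H`, so
    -- that fullness lifts the arrow to `𝒳`.
    obtain ⟨a', e, he⟩ := hH b
    have hb : 𝒴.p.obj b = R := IsHomLift.domain_eq 𝒴.p f φ
    subst hb
    have hl : 𝒴.p.IsCartesian f (e.hom ≫ φ) := inferInstance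
    have hs : 𝒴.p.IsStronglyCartesian f (H.map (H.toFunctor.preimage (e.hom ≫ φ))) := by
      rw [H.toFunctor.map_preimage]
      infer_instance
    have hψ := (H.isHomLift_iff f (H.toFunctor.preimage (e.hom ≫ φ))).1 hs.toIsHomLift
    refine ⟨a', H.toFunctor.preimage (e.hom ≫ φ), ⟨?_⟩⟩
    intro c g χ hχ
    obtain ⟨θ, ⟨hθ₁, hθ₂⟩, hθ⟩ := Functor.IsStronglyCartesian.universal_property 𝒴.p f
      (H.map (H.toFunctor.preimage (e.hom ≫ φ))) g (g ≫ f) rfl (H.map χ)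
    obtain ⟨θ, rfl⟩ := H.toFunctor.map_surjective θ
    refine ⟨θ, ⟨(H.isHomLift_iff g θ).1 hθ₁, H.toFunctor.map_injective ?_⟩, ?_⟩
    · rw [H.toFunctor.map_comp]
      exact hθ₂
    · rintro θ' ⟨h₁, h₂⟩
      refine H.toFunctor.map_injective (hθ _ ⟨inferInstance, ?_⟩)
      rw [← h₂, H.toFunctor.map_comp]
  isIso_fiber S a b φ := by
    obtain ⟨φ, hφ⟩ := φ
    let a' : 𝒴.p.Fiber S := ⟨H.obj a.1, (H.w_obj _).trans a.2⟩
    let b' : 𝒴.p.Fiber S := ⟨H.obj b.1, (H.w_obj _).trans b.2⟩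
    let ψ : a' ⟶ b' := ⟨H.map φ, inferInstance⟩
    have h : IsIso ψ := h𝒴.isIso_fiber S ψ
    have h' : IsIso (H.map φ) := Functor.map_isIso Functor.Fiber.fiberInclusion ψ
    have hi : IsIso φ := isIso_of_fully_faithful H.toFunctor φ
    refine ⟨⟨inv φ, IsHomLift.lift_id_inv_isIso 𝒳.p S φ⟩, ?_, ?_⟩
    · exact Subtype.ext (IsIso.hom_inv_id φ)
    · exact Subtype.ext (IsIso.inv_hom_id φ)

end

section

variable {𝒳 𝒴 : BasedCategory.{u, u + 1} 𝒮} (H : BasedFunctor 𝒳 𝒴)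

/-- A fully faithful functor over `𝒮` which is essentially surjective up to isomorphisms over
identities is an equivalence over `𝒮`. -/
theorem nonempty_equivalence [H.toFunctor.Full] [H.toFunctor.Faithful]
    (hH : ∀ b : 𝒴.obj, ∃ (a : 𝒳.obj) (e : H.obj a ≅ b), 𝒴.p.IsHomLift (𝟙 (𝒴.p.obj b)) e.hom) :
    Nonempty (Bicategory.Equivalence 𝒳 𝒴) := by
  choose k e he using hH
  have hinv : ∀ b, 𝒴.p.IsHomLift (𝟙 (𝒴.p.obj b)) (e b).inv := fun b =>
    IsHomLift.lift_id_inv 𝒴.p (𝒴.p.obj b) (e b)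
  let K₀ : 𝒴.obj ⥤ 𝒳.obj :=
    { obj := k
      map := fun {b b'} f => H.toFunctor.preimage ((e b).hom ≫ f ≫ (e b').inv)
      map_id := fun b => H.toFunctor.map_injective (by simp)
      map_comp := fun f g => H.toFunctor.map_injective (by simp) }
  have hK₀ : ∀ {b b' : 𝒴.obj} (f : b ⟶ b'),
      H.map (K₀.map f) = (e b).hom ≫ f ≫ (e b').inv := fun f => H.toFunctor.map_preimage _
  have hlift : ∀ {b b' : 𝒴.obj} (f : b ⟶ b'), 𝒳.p.IsHomLift (𝒴.p.map f) (K₀.map f) := by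
    intro b b' f
    rw [← H.isHomLift_iff, hK₀]
    infer_instance
  -- A based functor commutes with the projections strictly. The required equality of base objects
  -- holds because `e b` lies over an identity.
  have hobj : ∀ b, 𝒳.p.obj (K₀.obj b) = 𝒴.p.obj b := fun b =>
    (H.w_obj (k b)).symm.trans (IsHomLift.domain_eq 𝒴.p (𝟙 (𝒴.p.obj b)) (e b).hom)
  let K : BasedFunctor 𝒴 𝒳 :=
    { toFunctor := K₀
      w := Functor.ext hobj fun b b' f => by
        have := hlift f
        exact IsHomLift.fac' 𝒳.p (𝒴.p.map f) (K₀.map f) }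
  let counit : K.comp H ≅ BasedFunctor.id 𝒴 := BasedNatIso.mkNatIso
    (NatIso.ofComponents (fun b => e b) fun {b b'} f => by
      change H.map (K₀.map f) ≫ (e b').hom = (e b).hom ≫ f
      simp [hK₀]) he
  let unit : BasedFunctor.id 𝒳 ≅ H.comp K := BasedNatIso.mkNatIso
    (NatIso.ofComponents (fun a => H.toFunctor.preimageIso (e (H.obj a)).symm) fun {a a'} f => by
      refine H.toFunctor.map_injective ?_
      change H.map (f ≫ H.toFunctor.preimage (e (H.obj a')).inv) =
        H.map (H.toFunctor.preimage (e (H.obj a)).inv ≫ K₀.map (H.map f))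
      simp [hK₀]) fun a => by
      change 𝒳.p.IsHomLift _ (H.toFunctor.preimage (e (H.obj a)).inv)
      rw [← H.isHomLift_iff, H.toFunctor.map_preimage, ← H.w_obj a]
      exact hinv _
  exact ⟨Bicategory.Equivalence.mkOfAdjointifyCounit (f := H) (g := K) unit counit⟩

end

end BasedFunctor

end CategoryTheory

/-! ### Proper and separated maps -/

open Filter Topology Bundle

section Topology

variable {E X Z : Type*} [TopologicalSpace E]

theorem IsSeparatedMap.eq_of_ultrafilter_le {p : E → X} (hp : IsSeparatedMap p)
    {𝒰 : Ultrafilter E} {a b : E} (hab : p a = p b) (ha : ↑𝒰 ≤ 𝓝 a) (hb : ↑𝒰 ≤ 𝓝 b) : a = b := by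
  by_contra h
  have := isSeparatedMap_iff_disjoint_nhds.1 hp a b hab h
  exact 𝒰.neBot.ne (le_bot_iff.1 (this ha hb))

theorem isSeparatedMap_of_ultrafilter {p : E → X}
    (h : ∀ (𝒰 : Ultrafilter E) (a b : E), p a = p b → ↑𝒰 ≤ 𝓝 a → ↑𝒰 ≤ 𝓝 b → a = b) :
    IsSeparatedMap p := by
  rw [isSeparatedMap_iff_disjoint_nhds]
  intro a b hab hne
  rw [disjoint_iff]
  by_contra hbot
  have : NeBot (𝓝 a ⊓ 𝓝 b) := ⟨hbot⟩
  have hle := Ultrafilter.of_le (𝓝 a ⊓ 𝓝 b)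
  exact hne (h _ a b hab (hle.trans inf_le_left) (hle.trans inf_le_right))

variable [TopologicalSpace X] [TopologicalSpace Z]

/-- Along an ultrafilter, a map whose projection to the base of a proper map converges has a
limit over the limit of the projection. -/
theorem IsProperMap.exists_tendsto {p : E → X} (hp : IsProperMap p) {Z : Type*}
    {𝒰 : Ultrafilter Z} {g : Z → E} {x : X} (h : Tendsto (fun z => p (g z)) 𝒰 (𝓝 x)) :
    ∃ a, p a = x ∧ Tendsto g 𝒰 (𝓝 a) := by
  obtain ⟨a, ha, hle⟩ := hp.ultrafilter_le_nhds_of_tendsto (𝒰 := 𝒰.map g) (y := x) h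
  exact ⟨a, ha, hle⟩

/-- A map to the source of a proper map is continuous if its projection is and if it has closed
graph in the appropriate sense. -/
theorem IsProperMap.continuous_of_forall_limit {p : E → X} (hp : IsProperMap p) {g : Z → E}
    (hpg : Continuous fun z => p (g z))
    (h : ∀ (z : Z) (𝒰 : Ultrafilter Z) (a : E), ↑𝒰 ≤ 𝓝 z → p a = p (g z) →
      Tendsto g 𝒰 (𝓝 a) → a = g z) : Continuous g := by
  rw [continuous_iff_ultrafilter]
  intro z 𝒰 h𝒰
  obtain ⟨a, ha, hta⟩ := hp.exists_tendsto ((hpg.tendsto z).mono_left h𝒰)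
  rwa [← h z 𝒰 a h𝒰 ha hta]

variable {F : Type*} [TopologicalSpace F]

theorem isSeparatedMap_of_trivialization [T2Space F] {p : E → X}
    (h : ∀ x : X, ∃ t : Trivialization F p, x ∈ t.baseSet) : IsSeparatedMap p := by
  refine isSeparatedMap_of_ultrafilter fun 𝒰 a b hab ha hb => ?_
  obtain ⟨t, ht⟩ := h (p a)
  have hta : a ∈ t.source := t.mem_source.2 ht
  have htb : b ∈ t.source := t.mem_source.2 (hab ▸ ht)
  have h1 : Tendsto (fun e => (t e).2) 𝒰 (𝓝 (t a).2) :=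
    (continuous_snd.tendsto _).comp ((t.continuousAt hta).mono_left ha)
  have h2 : Tendsto (fun e => (t e).2) 𝒰 (𝓝 (t b).2) :=
    (continuous_snd.tendsto _).comp ((t.continuousAt htb).mono_left hb)
  refine t.injOn hta htb (Prod.ext ?_ (tendsto_nhds_unique h1 h2))
  change (t a).1 = (t b).1
  rw [t.coe_fst hta, t.coe_fst htb, hab]

theorem isProperMap_of_trivialization [CompactSpace F] {p : E → X} (hp : Continuous p)
    (h : ∀ x : X, ∃ t : Trivialization F p, x ∈ t.baseSet) : IsProperMap p := by
  refine isProperMap_iff_ultrafilter.2 ⟨hp, fun 𝒰 x h𝒰 => ?_⟩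
  obtain ⟨t, ht⟩ := h x
  obtain ⟨f, -, hf⟩ := isCompact_univ.ultrafilter_le_nhds (𝒰.map fun e => (t e).2) (by simp)
  have hmem : ∀ᶠ e in (𝒰 : Filter E), e ∈ t.source := by
    filter_upwards [h𝒰 (t.open_baseSet.mem_nhds ht)] with e he
    exact t.mem_source.2 he
  have htend : Tendsto (fun e => (p e, (t e).2)) 𝒰 (𝓝 (x, f)) := h𝒰.prodMk_nhds hf
  have hxf : (x, f) ∈ t.target := t.mem_target.2 ht
  refine ⟨t.toPartialEquiv.symm (x, f), t.proj_symm_apply hxf, ?_⟩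
  have hc := (t.toOpenPartialHomeomorph.continuousAt_symm hxf).tendsto.comp htend
  refine tendsto_id'.1 (hc.congr' ?_)
  filter_upwards [hmem] with e he
  exact t.symm_apply_mk_proj he

/-! ### Principal bundles of finite discrete groups -/

variable {G : Type*} [Group G] [TopologicalSpace G] [DiscreteTopology G] [Finite G]
  [MulAction Gᵐᵒᵖ E] [ContinuousConstSMul Gᵐᵒᵖ E]

open MulOpposite in
/-- A separated proper map with a fiberwise simply transitive action of a finite discrete group is
a principal bundle. -/
theorem exists_equivariant_trivialization {p : E → X} (hp : IsProperMap p)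
    (hsep : IsSeparatedMap p) (hsurj : Function.Surjective p)
    (hinv : ∀ (g : G) (e : E), p (op g • e) = p e)
    (htrans : ∀ e e' : E, p e = p e' → ∃ g : G, op g • e = e')
    (hfree : ∀ (e : E) (g : G), op g • e = e → g = 1) (x : X) :
    ∃ t : Trivialization G p, x ∈ t.baseSet ∧
      ∀ e ∈ t.source, ∀ g : G, (t (op g • e)).2 = (t e).2 * g := by
  obtain ⟨e₀, rfl⟩ := hsurj x
  have hsep' : ∀ g : G, ∃ W : Set E, IsOpen W ∧ e₀ ∈ W ∧
      (g ≠ 1 → ∀ e ∈ W, op g • e ∉ W) := by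
    intro g
    by_cases hg : g = 1
    · exact ⟨Set.univ, isOpen_univ, trivial, fun h => absurd hg h⟩
    · obtain ⟨A, B, hA, hB, heA, heB, hAB⟩ := hsep e₀ (op g • e₀) (hinv g e₀).symm
        fun h => hg (hfree e₀ g h.symm)
      refine ⟨A ∩ (fun e => op g • e) ⁻¹' B, hA.inter (hB.preimage (continuous_const_smul _)),
        ⟨heA, heB⟩, fun _ e he he' => ?_⟩
      exact Set.disjoint_left.1 hAB he'.1 he.2
  choose W' hW'o hW'e hW'd using hsep'
  -- Finiteness of `G` keeps `W` open; its translates are pairwise disjoint.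
  let W : Set E := ⋂ g, W' g
  have hWo : IsOpen W := isOpen_iInter_of_finite hW'o
  have hWe : e₀ ∈ W := Set.mem_iInter.2 hW'e
  have hWd : ∀ (g : G) (e : E), e ∈ W → op g • e ∈ W → g = 1 := by
    intro g e he he'
    by_contra hg
    exact hW'd g hg e (Set.mem_iInter.1 he g) (Set.mem_iInter.1 he' g)
  have hWg : ∀ g : G, IsOpen {e : E | op g⁻¹ • e ∈ W} := fun g =>
    hWo.preimage (continuous_const_smul _)
  let O : Set E := ⋃ g : G, {e : E | op g⁻¹ • e ∈ W}
  have hO : IsOpen O := isOpen_iUnion hWg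
  -- Tube argument: the translates of `W` cover the fiber of `e₀`, and since `p` is closed they
  -- cover all fibers over a neighborhood.
  let V : Set X := (p '' Oᶜ)ᶜ
  have hV : IsOpen V := (hp.isClosedMap _ hO.isClosed_compl).isOpen_compl
  have hVO : ∀ e, p e ∈ V → ∃ g : G, op g⁻¹ • e ∈ W := by
    intro e he
    by_contra h
    exact he ⟨e, fun h' => h (Set.mem_iUnion.1 h'), rfl⟩
  have hxV : p e₀ ∈ V := by
    rintro ⟨e, he, hee⟩
    obtain ⟨g, rfl⟩ := htrans e₀ e hee.symm
    refine he (Set.mem_iUnion.2 ⟨g, ?_⟩)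
    change op g⁻¹ • op g • e₀ ∈ W
    rwa [← mul_smul, ← op_mul, mul_inv_cancel, op_one, one_smul]
  have huniq : ∀ (e : E) (g h : G), op g⁻¹ • e ∈ W → op h⁻¹ • e ∈ W → g = h := by
    intro e g h hg hh
    have h1 : op (g * h⁻¹) • op g⁻¹ • e ∈ W := by
      rwa [← mul_smul, ← op_mul, inv_mul_cancel_left]
    exact mul_inv_eq_one.1 (hWd _ _ hg h1)
  have hWinj : ∀ e ∈ W, ∀ e' ∈ W, p e = p e' → e = e' := by
    intro e he e' he' hee
    obtain ⟨g, rfl⟩ := htrans e e' hee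
    rw [hWd g e he he', op_one, one_smul]
  have hsec : ∀ y : X, ∃ e : E, p e = y ∧ (y ∈ V → e ∈ W) := by
    intro y
    obtain ⟨e, rfl⟩ := hsurj y
    by_cases hy : p e ∈ V
    · obtain ⟨g, hg⟩ := hVO e hy
      exact ⟨_, hinv _ _, fun _ => hg⟩
    · exact ⟨e, rfl, fun h => absurd h hy⟩
  choose s hs hsW using hsec
  -- A limit of values of `s` lies in some translate of `W`. That translate is open, so it contains
  -- values of `s`, which are in `W`; by disjointness it is `W` itself, where a point is determined
  -- by its projection.
  have hscont : ContinuousOn s V := by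
    rw [continuousOn_iff_continuous_domRestrict]
    refine hp.continuous_of_forall_limit ?_ ?_
    · simpa only [Set.domRestrict_apply, hs] using continuous_subtype_val
    · intro y 𝒰 a h𝒰 ha hta
      have hpa : p a = y.1 := ha.trans (hs _)
      obtain ⟨g, hg⟩ := hVO a (hpa ▸ y.2)
      obtain ⟨z, hz⟩ := (hta.eventually ((hWg g).mem_nhds hg)).exists
      have hz' : op (1 : G)⁻¹ • s z ∈ W := by simpa using hsW z z.2
      have hg1 : g = 1 := huniq _ _ _ hz hz'
      subst hg1
      refine hWinj a ?_ (s y) (hsW y y.2) ha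
      simpa using hg
  -- The fiber coordinate `γ e` names the translate of `W` containing `e`; it is locally constant
  -- since translates are open and disjoint.
  have hγ : ∀ e, ∃ g : G, p e ∈ V → op g⁻¹ • e ∈ W := by
    intro e
    by_cases he : p e ∈ V
    · obtain ⟨g, hg⟩ := hVO e he
      exact ⟨g, fun _ => hg⟩
    · exact ⟨1, fun h => absurd h he⟩
  choose γ hγ using hγ
  have hγcont : ContinuousOn γ (p ⁻¹' V) := by
    intro e he
    refine ContinuousAt.continuousWithinAt ?_
    refine (continuousAt_const (y := γ e)).congr ?_
    filter_upwards [(hV.preimage hp.continuous).mem_nhds he,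
      (hWg (γ e)).mem_nhds (hγ e he)] with e' h1 h2
    exact huniq e' _ _ h2 (hγ e' h1)
  refine ⟨
    { toFun := fun e => (p e, γ e)
      invFun := fun y => op y.2 • s y.1
      source := p ⁻¹' V
      target := V ×ˢ Set.univ
      map_source' := fun e he => ⟨he, trivial⟩
      map_target' := fun y hy => by
        change p _ ∈ V
        rw [hinv, hs]
        exact hy.1
      left_inv' := fun e he => by
        have h : s (p e) = op (γ e)⁻¹ • e :=
          hWinj _ (hsW _ he) _ (hγ e he) (by rw [hs, hinv])
        change op (γ e) • s (p e) = e
        rw [h, ← mul_smul, ← op_mul, inv_mul_cancel, op_one, one_smul]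
      right_inv' := fun y hy => by
        have hpy : p (op y.2 • s y.1) = y.1 := by rw [hinv, hs]
        refine Prod.ext hpy ?_
        refine huniq (op y.2 • s y.1) _ _ (hγ _ (by rw [hpy]; exact hy.1)) ?_
        rw [← mul_smul, ← op_mul, mul_inv_cancel, op_one, one_smul]
        exact hsW _ hy.1
      open_source := hV.preimage hp.continuous
      open_target := hV.prod isOpen_univ
      continuousOn_toFun := hp.continuous.continuousOn.prodMk hγcont
      continuousOn_invFun := by
        rintro ⟨y, g⟩ hy
        have h1 : ContinuousAt (fun z : X × G => op g • s z.1) (y, g) :=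
          ((hscont.continuousAt (hV.mem_nhds hy.1)).comp continuousAt_fst).const_smul (op g)
        refine (h1.congr ?_).continuousWithinAt
        filter_upwards [(continuous_snd.tendsto (y, g)).eventually
          ((isOpen_discrete {g}).mem_nhds rfl)] with z hz
        have hzg : z.2 = g := hz
        rw [hzg]
      baseSet := V
      open_baseSet := hV
      source_eq := rfl
      target_eq := rfl
      proj_toFun := fun _ _ => rfl }, hxV, ?_⟩
  intro e he g
  change γ (op g • e) = γ e * g
  have he' : p (op g • e) ∈ V := by
    rw [hinv]
    exact he
  refine huniq _ _ _ (hγ _ he') ?_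
  rw [← mul_smul, ← op_mul, mul_inv_rev, mul_inv_cancel_left]
  exact hγ e he

end Topology

/-- A commutative square of spaces which is bijective on fibers is cartesian if its left side is
proper and its right side is separated. -/
theorem TopCat.isPullback_of_bijOn {E' E X' X : TopCat.{u}} {t : E' ⟶ E} {p' : E' ⟶ X'}
    {p : E ⟶ X} {f : X' ⟶ X} (comm : ∀ a, p (t a) = f (p' a)) (hp' : IsProperMap p')
    (hp : IsSeparatedMap p) (hb : ∀ x, Set.BijOn t {a | p' a = x} {a | p a = f x}) :
    IsPullback t p' p f := by
  have w : t ≫ p = p' ≫ f := by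
    ext a
    exact comm a
  refine ⟨⟨w⟩, ⟨Limits.PullbackCone.IsLimit.mk w ?_ ?_ ?_ ?_⟩⟩
  · intro s
    have hs : ∀ z : s.pt, p (s.fst z) = f (s.snd z) := fun z =>
      ConcreteCategory.congr_hom s.condition z
    have hex : ∀ z : s.pt, ∃ a : E', p' a = s.snd z ∧ t a = s.fst z := fun z =>
      (hb (s.snd z)).surjOn (hs z)
    refine TopCat.ofHom ⟨fun z => (hex z).choose, ?_⟩
    -- Properness supplies limits of the lifted points. Their images under `t` converge to the
    -- expected point because `p` is separated, and injectivity of `t` on the fiber identifies the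
    -- limit.
    refine hp'.continuous_of_forall_limit ?_ ?_
    · simp only [(hex _).choose_spec.1]
      exact s.snd.hom.continuous
    · intro z 𝒰 a h𝒰 ha hta
      refine (hb (p' a)).injOn rfl ha.symm ?_
      have h1 : Tendsto (fun z => s.fst z) 𝒰 (𝓝 (t a)) := by
        refine ((t.hom.continuous.tendsto a).comp hta).congr fun z => ?_
        exact (hex z).choose_spec.2
      have h2 : Tendsto (fun z => s.fst z) 𝒰 (𝓝 (s.fst z)) :=
        (s.fst.hom.continuous.tendsto z).mono_left h𝒰
      refine (hp.eq_of_ultrafilter_le (𝒰 := 𝒰.map fun z => s.fst z) ?_ h1 h2).trans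
        (hex z).choose_spec.2.symm
      rw [comm, ha, (hex z).choose_spec.1, hs]
  · intro s
    ext z
    exact (Exists.choose_spec (_ : ∃ a : E', p' a = s.snd z ∧ t a = s.fst z)).2
  · intro s
    ext z
    exact (Exists.choose_spec (_ : ∃ a : E', p' a = s.snd z ∧ t a = s.fst z)).1
  · intro s m hm₁ hm₂
    ext z
    have h : ∃ a : E', p' a = s.snd z ∧ t a = s.fst z :=
      ⟨m z, ConcreteCategory.congr_hom hm₂ z, ConcreteCategory.congr_hom hm₁ z⟩
    refine (hb (s.snd z)).injOn (ConcreteCategory.congr_hom hm₂ z) h.choose_spec.1 ?_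
    exact (ConcreteCategory.congr_hom hm₁ z).trans h.choose_spec.2.symm

/-! ### Barycentric coordinates in a triangle -/

/-- The standard `2`-simplex of barycentric coordinates. -/
def BarySimplex : Type :=
  {s : Fin 3 → ℝ // (∀ i, 0 ≤ s i) ∧ s 0 + s 1 + s 2 = 1}

namespace BarySimplex

instance : TopologicalSpace BarySimplex := inferInstanceAs (TopologicalSpace (Subtype _))

instance : T2Space BarySimplex := inferInstanceAs (T2Space (Subtype _))

instance : CompactSpace BarySimplex := by
  have h : {s : Fin 3 → ℝ | (∀ i, 0 ≤ s i) ∧ s 0 + s 1 + s 2 = 1} = stdSimplex ℝ (Fin 3) := by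
    ext s
    simp [stdSimplex, Fin.sum_univ_three]
  have hc : IsCompact {s : Fin 3 → ℝ | (∀ i, 0 ≤ s i) ∧ s 0 + s 1 + s 2 = 1} :=
    h ▸ isCompact_stdSimplex ℝ (Fin 3)
  exact isCompact_iff_compactSpace.1 hc

theorem sum_perm (σ : Equiv.Perm (Fin 3)) (f : Fin 3 → ℝ) :
    f (σ 0) + f (σ 1) + f (σ 2) = f 0 + f 1 + f 2 := by
  have h := Equiv.sum_comp σ f
  simpa only [Fin.sum_univ_three] using h

/-- The symmetric group permutes the coordinates. -/
instance : MulAction (Equiv.Perm (Fin 3)) BarySimplex where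
  smul σ s := ⟨fun i => s.1 (σ⁻¹ i), fun _ => s.2.1 _, (sum_perm σ⁻¹ s.1).trans s.2.2⟩
  one_smul _ := rfl
  mul_smul σ τ s := by
    apply Subtype.ext
    funext i
    change s.1 ((σ * τ)⁻¹ i) = s.1 (τ⁻¹ (σ⁻¹ i))
    rw [mul_inv_rev, Equiv.Perm.mul_apply]

theorem smul_val (σ : Equiv.Perm (Fin 3)) (s : BarySimplex) (i : Fin 3) :
    (σ • s).1 i = s.1 (σ⁻¹ i) := rfl

theorem continuous_val : Continuous fun s : BarySimplex => s.1 := continuous_subtype_val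

instance : ContinuousSMul (Equiv.Perm (Fin 3)) BarySimplex where
  continuous_smul := continuous_prod_of_discrete_left.mpr fun σ =>
    Continuous.subtype_mk
      (continuous_pi fun i => (continuous_apply (σ⁻¹ i)).comp continuous_val) _

/-- The vertices of the simplex. -/
def vertex (i : Fin 3) : BarySimplex :=
  ⟨Pi.single i 1, fun j => by
    rcases eq_or_ne j i with rfl | h
    · simp
    · simp [h], by
    fin_cases i <;> simp⟩

theorem vertex_val (i : Fin 3) : (vertex i).1 = Pi.single i 1 := rfl

theorem smul_vertex (σ : Equiv.Perm (Fin 3)) (i : Fin 3) : σ • vertex i = vertex (σ i) := by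
  apply Subtype.ext
  funext j
  rw [smul_val, vertex_val, vertex_val, Pi.single_apply, Pi.single_apply]
  exact if_congr (Equiv.Perm.inv_eq_iff_eq.trans Iff.rfl) rfl rfl

theorem vertex_injective : Function.Injective vertex := by
  intro i j h
  have h' := congrArg (fun s : BarySimplex => s.1 i) h
  by_contra hij
  simp [vertex_val, hij] at h'

theorem eq_vertex {s : BarySimplex} {i : Fin 3} (h : ∀ j, j ≠ i → s.1 j = 0) : s = vertex i := by
  apply Subtype.ext
  funext j
  rw [vertex_val]
  obtain ⟨s, hs, hsum⟩ := s
  rcases eq_or_ne j i with rfl | hj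
  · rw [Pi.single_eq_same]
    change s j = 1
    have h' : ∀ k, k ≠ j → s k = 0 := h
    fin_cases j
    · have h1 := h' 1 (by decide)
      have h2 := h' 2 (by decide)
      change s 0 = 1
      linarith
    · have h1 := h' 0 (by decide)
      have h2 := h' 2 (by decide)
      change s 1 = 1
      linarith
    · have h1 := h' 0 (by decide)
      have h2 := h' 1 (by decide)
      change s 2 = 1
      linarith
  · rw [Pi.single_eq_of_ne hj]
    exact h j hj

theorem exists_pos (s : BarySimplex) : ∃ i, 0 < s.1 i := by
  by_contra! h
  have := s.2.2
  linarith [h 0, h 1, h 2]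

/-- The determinant of three points of the simplex. -/
def det (s : Fin 3 → BarySimplex) : ℝ :=
  (s 0).1 0 * ((s 1).1 1 * (s 2).1 2 - (s 1).1 2 * (s 2).1 1)
    - (s 0).1 1 * ((s 1).1 0 * (s 2).1 2 - (s 1).1 2 * (s 2).1 0)
    + (s 0).1 2 * ((s 1).1 0 * (s 2).1 1 - (s 1).1 1 * (s 2).1 0)

/-- The product of the three coordinate sums is one and expands into 27 nonnegative monomials. Even
and odd permutations contribute sums `P` and `N` with `det s = P - N`. If this has absolute value at
least one, then `P + N ≥ 1` and nothing is left for the monomials with a repeated index. -/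
theorem mul_eq_zero_of_one_le_det_sq {s : Fin 3 → BarySimplex} (h : 1 ≤ det s ^ 2)
    (f : Fin 3 → Fin 3) (hf : ¬ Function.Injective f) :
    (s 0).1 (f 0) * (s 1).1 (f 1) * (s 2).1 (f 2) = 0 := by
  classical
  let T : Fin 3 → Fin 3 → Fin 3 → ℝ := fun a b c =>
    if a = b ∨ a = c ∨ b = c then (s 0).1 a * (s 1).1 b * (s 2).1 c else 0
  have hT : ∀ a b c, 0 ≤ T a b c := by
    intro a b c
    dsimp only [T]
    split_ifs
    · exact mul_nonneg (mul_nonneg ((s 0).2.1 a) ((s 1).2.1 b)) ((s 2).2.1 c)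
    · exact le_rfl
  have hpos : ∀ a b c, 0 ≤ (s 0).1 a * (s 1).1 b * (s 2).1 c := fun a b c =>
    mul_nonneg (mul_nonneg ((s 0).2.1 a) ((s 1).2.1 b)) ((s 2).2.1 c)
  have hsum : ∑ a, ∑ b, ∑ c, T a b c +
      (((s 0).1 0 * (s 1).1 1 * (s 2).1 2 + (s 0).1 1 * (s 1).1 2 * (s 2).1 0
        + (s 0).1 2 * (s 1).1 0 * (s 2).1 1)
      + ((s 0).1 0 * (s 1).1 2 * (s 2).1 1 + (s 0).1 1 * (s 1).1 0 * (s 2).1 2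
        + (s 0).1 2 * (s 1).1 1 * (s 2).1 0)) = 1 := by
    have h1 : ((s 0).1 0 + (s 0).1 1 + (s 0).1 2) * ((s 1).1 0 + (s 1).1 1 + (s 1).1 2)
      * ((s 2).1 0 + (s 2).1 1 + (s 2).1 2) = 1 := by
      rw [(s 0).2.2, (s 1).2.2, (s 2).2.2]
      norm_num
    refine Eq.trans ?_ h1
    simp [T, Fin.sum_univ_three]
    ring
  have hzero : ∑ a, ∑ b, ∑ c, T a b c = 0 := by
    refine le_antisymm ?_ (Finset.sum_nonneg fun a _ => Finset.sum_nonneg fun b _ =>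
      Finset.sum_nonneg fun c _ => hT a b c)
    have hd : det s = ((s 0).1 0 * (s 1).1 1 * (s 2).1 2 + (s 0).1 1 * (s 1).1 2 * (s 2).1 0
        + (s 0).1 2 * (s 1).1 0 * (s 2).1 1)
      - ((s 0).1 0 * (s 1).1 2 * (s 2).1 1 + (s 0).1 1 * (s 1).1 0 * (s 2).1 2
        + (s 0).1 2 * (s 1).1 1 * (s 2).1 0) := by
      unfold det
      ring
    rcases le_abs.1 (one_le_sq_iff_one_le_abs _ |>.1 h) with h' | h' <;>
      linarith [hpos 0 1 2, hpos 1 2 0, hpos 2 0 1, hpos 0 2 1, hpos 1 0 2, hpos 2 1 0]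
  have h0 := (Finset.sum_eq_zero_iff_of_nonneg fun a _ => Finset.sum_nonneg fun b _ =>
      Finset.sum_nonneg fun c _ => hT a b c).1 hzero (f 0) (Finset.mem_univ _)
  have h1 := (Finset.sum_eq_zero_iff_of_nonneg fun b _ =>
      Finset.sum_nonneg fun c _ => hT (f 0) b c).1 h0 (f 1) (Finset.mem_univ _)
  have h2 := (Finset.sum_eq_zero_iff_of_nonneg fun c _ => hT (f 0) (f 1) c).1 h1 (f 2)
    (Finset.mem_univ _)
  have hcond : f 0 = f 1 ∨ f 0 = f 2 ∨ f 1 = f 2 := by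
    by_contra! hne
    obtain ⟨h01, h02, h12⟩ := hne
    refine hf fun i j hij => ?_
    fin_cases i <;> fin_cases j <;>
      first
        | rfl
        | exact absurd hij h01
        | exact absurd hij h02
        | exact absurd hij h12
        | exact absurd hij.symm h01
        | exact absurd hij.symm h02
        | exact absurd hij.symm h12
  simpa only [T, if_pos hcond] using h2

/-- Three points of the simplex whose determinant has absolute value at least one are the three
vertices. -/
theorem exists_perm_of_one_le_det_sq {s : Fin 3 → BarySimplex} (h : 1 ≤ det s ^ 2) :
    ∃ σ : Equiv.Perm (Fin 3), ∀ i, s i = vertex (σ i) := by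
  -- Any choice of one positive coordinate for each point must be injective, since its monomial is
  -- nonzero.
  choose f hf using fun i => (s i).exists_pos
  have hinj : ∀ g : Fin 3 → Fin 3, (∀ i, 0 < (s i).1 (g i)) → Function.Injective g := by
    intro g hg
    by_contra hn
    have := mul_eq_zero_of_one_le_det_sq h g hn
    exact absurd this (mul_pos (mul_pos (hg 0) (hg 1)) (hg 2)).ne'
  have hfi := hinj f hf
  refine ⟨Equiv.ofBijective f (Finite.injective_iff_bijective.1 hfi), fun i => ?_⟩
  refine eq_vertex fun j hj => ?_
  by_contra hne
  have hpos : 0 < (s i).1 j := lt_of_le_of_ne ((s i).2.1 j) (Ne.symm hne)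
  obtain ⟨k, hk⟩ := (Finite.injective_iff_bijective.1 hfi).2 j
  have hki : k ≠ i := by
    rintro rfl
    exact hj hk.symm
  -- A second positive coordinate `j = f k` of the `i`-th point gives another choice, which takes
  -- the value `j` at both `i` and `k`.
  have hg : Function.Injective (Function.update f i j) := by
    refine hinj _ fun l => ?_
    rcases eq_or_ne l i with rfl | hl
    · simpa using hpos
    · simpa [hl] using hf l
  refine hki (hg ?_)
  rw [Function.update_self, Function.update_of_ne hki, hk]

theorem det_vertex_sq (σ : Equiv.Perm (Fin 3)) : det (fun i => vertex (σ i)) ^ 2 = 1 := by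
  have h01 : σ 0 ≠ σ 1 := fun h => absurd (σ.injective h) (by decide)
  have h02 : σ 0 ≠ σ 2 := fun h => absurd (σ.injective h) (by decide)
  have h12 : σ 1 ≠ σ 2 := fun h => absurd (σ.injective h) (by decide)
  unfold det
  simp only [vertex_val]
  generalize σ 0 = a at *
  generalize σ 1 = b at *
  generalize σ 2 = c at *
  fin_cases a <;> fin_cases b <;> fin_cases c <;> simp at *

/-- A square above one would force the points to be the vertices, where the square is exactly one.
-/
theorem det_sq_le_one (s : Fin 3 → BarySimplex) : det s ^ 2 ≤ 1 := by
  by_contra! h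
  obtain ⟨σ, hσ⟩ := exists_perm_of_one_le_det_sq h.le
  rw [funext hσ, det_vertex_sq] at h
  exact lt_irrefl _ h

end BarySimplex

/-- Sixteen times the squared area of a triangle with squared edge lengths `x`, `y`, `z`. -/
def heronSq (x y z : ℝ) : ℝ := 4 * x * y - (x + y - z) ^ 2

namespace OrientedModuli

/-- The squared distance of two points of a triangle with edge lengths `m`, in terms of barycentric
coordinates. -/
def sqDist (m : OrientedModuli) (s t : BarySimplex) : ℝ :=
  -((s.1 1 - t.1 1) * (s.1 2 - t.1 2) * m.1 0 ^ 2 + (s.1 0 - t.1 0) * (s.1 2 - t.1 2) * m.1 1 ^ 2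
    + (s.1 0 - t.1 0) * (s.1 1 - t.1 1) * m.1 2 ^ 2)

theorem continuous_val : Continuous fun m : OrientedModuli => m.1 := continuous_subtype_val

theorem smul_val (σ : Equiv.Perm (Fin 3)) (m : OrientedModuli) (i : Fin 3) :
    (σ • m).1 i = m.1 (σ⁻¹ i) := rfl

theorem continuous_sqDist :
    Continuous fun q : OrientedModuli × BarySimplex × BarySimplex => sqDist q.1 q.2.1 q.2.2 := by
  have hm : ∀ i, Continuous fun q : OrientedModuli × BarySimplex × BarySimplex => q.1.1 i :=
    fun i => (continuous_apply i).comp (continuous_val.comp continuous_fst)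
  have hs : ∀ i, Continuous fun q : OrientedModuli × BarySimplex × BarySimplex => q.2.1.1 i :=
    fun i => (continuous_apply i).comp
      (BarySimplex.continuous_val.comp (continuous_fst.comp continuous_snd))
  have ht : ∀ i, Continuous fun q : OrientedModuli × BarySimplex × BarySimplex => q.2.2.1 i :=
    fun i => (continuous_apply i).comp
      (BarySimplex.continuous_val.comp (continuous_snd.comp continuous_snd))
  unfold sqDist
  exact (((((hs 1).sub (ht 1)).mul ((hs 2).sub (ht 2))).mul ((hm 0).pow 2)).add
    ((((hs 0).sub (ht 0)).mul ((hs 2).sub (ht 2))).mul ((hm 1).pow 2))).add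
    ((((hs 0).sub (ht 0)).mul ((hs 1).sub (ht 1))).mul ((hm 2).pow 2)) |>.neg

theorem continuousAt_sqrt_sqDist {Z : Type*} [TopologicalSpace Z] {m : Z → OrientedModuli}
    {s t : Z → BarySimplex} {z : Z} (hm : ContinuousAt m z) (hs : ContinuousAt s z)
    (ht : ContinuousAt t z) : ContinuousAt (fun z => √(sqDist (m z) (s z) (t z))) z :=
  ContinuousAt.comp (f := fun z => (m z, s z, t z))
    (g := fun q : OrientedModuli × BarySimplex × BarySimplex => √(sqDist q.1 q.2.1 q.2.2))
    (Real.continuous_sqrt.comp continuous_sqDist).continuousAt (hm.prodMk (hs.prodMk ht))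

/-- Heron's formula: the expression is the product of the perimeter and the defects of the three
strict triangle inequalities. -/
theorem heronSq_pos (m : OrientedModuli) : 0 < heronSq (m.1 0 ^ 2) (m.1 1 ^ 2) (m.1 2 ^ 2) := by
  obtain ⟨m, ⟨h1, h2⟩, ⟨h3, h4⟩, h5, h6⟩ := m
  have h : heronSq (m 0 ^ 2) (m 1 ^ 2) (m 2 ^ 2) =
      (m 0 + m 1 + m 2) * (m 1 + m 2 - m 0) * (m 0 + m 2 - m 1) * (m 0 + m 1 - m 2) := by
    unfold heronSq
    ring
  change 0 < heronSq (m 0 ^ 2) (m 1 ^ 2) (m 2 ^ 2)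
  rw [h]
  have a1 : 0 < m 0 + m 1 + m 2 := by linarith
  have a2 : 0 < m 1 + m 2 - m 0 := by linarith
  have a3 : 0 < m 0 + m 2 - m 1 := by linarith
  have a4 : 0 < m 0 + m 1 - m 2 := by linarith
  positivity

/-- With the last coordinate eliminated, `sqDist` is a binary quadratic form whose negated
discriminant is `heronSq`. Completing the square shows that it is positive definite. -/
theorem four_mul_sqDist (m : OrientedModuli) (s t : BarySimplex) :
    4 * m.1 1 ^ 2 * sqDist m s t =
      (2 * m.1 1 ^ 2 * (s.1 0 - t.1 0) + (m.1 0 ^ 2 + m.1 1 ^ 2 - m.1 2 ^ 2) * (s.1 1 - t.1 1)) ^ 2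
      + heronSq (m.1 0 ^ 2) (m.1 1 ^ 2) (m.1 2 ^ 2) * (s.1 1 - t.1 1) ^ 2 := by
  have hs : s.1 2 = 1 - s.1 0 - s.1 1 := by linarith [s.2.2]
  have ht : t.1 2 = 1 - t.1 0 - t.1 1 := by linarith [t.2.2]
  unfold sqDist heronSq
  rw [hs, ht]
  ring

theorem sqDist_nonneg (m : OrientedModuli) (s t : BarySimplex) : 0 ≤ sqDist m s t := by
  have h := four_mul_sqDist m s t
  have hm : 0 < 4 * m.1 1 ^ 2 := by
    have := m.2.2.1.1
    positivity
  have hH := m.heronSq_pos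
  refine nonneg_of_mul_nonneg_right (a := 4 * m.1 1 ^ 2) ?_ hm
  rw [h]
  positivity

theorem eq_of_sqDist_eq_zero {m : OrientedModuli} {s t : BarySimplex} (h : sqDist m s t = 0) :
    s = t := by
  have h4 := four_mul_sqDist m s t
  rw [h, mul_zero] at h4
  have hH := m.heronSq_pos
  have hm := m.2.2.1.1
  have h1 : (s.1 1 - t.1 1) ^ 2 = 0 := by
    have : heronSq (m.1 0 ^ 2) (m.1 1 ^ 2) (m.1 2 ^ 2) * (s.1 1 - t.1 1) ^ 2 = 0 :=
      le_antisymm (by nlinarith [sq_nonneg (2 * m.1 1 ^ 2 * (s.1 0 - t.1 0)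
        + (m.1 0 ^ 2 + m.1 1 ^ 2 - m.1 2 ^ 2) * (s.1 1 - t.1 1))]) (by positivity)
    exact (mul_eq_zero.1 this).resolve_left hH.ne'
  have h1' : s.1 1 - t.1 1 = 0 := pow_eq_zero_iff two_ne_zero |>.1 h1
  have h0 : s.1 0 - t.1 0 = 0 := by
    rw [h1'] at h4
    have h5 : (2 * m.1 1 ^ 2) * (s.1 0 - t.1 0) = 0 := by
      refine pow_eq_zero_iff two_ne_zero |>.1 ?_
      linarith
    exact (mul_eq_zero.1 h5).resolve_left (by positivity)
  apply Subtype.ext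
  funext i
  fin_cases i
  · exact sub_eq_zero.1 h0
  · exact sub_eq_zero.1 h1'
  · change s.1 2 = t.1 2
    linarith [s.2.2, t.2.2]

theorem sqDist_self (m : OrientedModuli) (s : BarySimplex) : sqDist m s s = 0 := by
  simp [sqDist]

theorem sqDist_smul (σ : Equiv.Perm (Fin 3)) (m : OrientedModuli) (s t : BarySimplex) :
    sqDist (σ • m) (σ • s) (σ • t) = sqDist m s t := by
  simp only [sqDist, smul_val, BarySimplex.smul_val]
  have h01 : σ⁻¹ 0 ≠ σ⁻¹ 1 := fun h => absurd (σ⁻¹.injective h) (by decide)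
  have h02 : σ⁻¹ 0 ≠ σ⁻¹ 2 := fun h => absurd (σ⁻¹.injective h) (by decide)
  have h12 : σ⁻¹ 1 ≠ σ⁻¹ 2 := fun h => absurd (σ⁻¹.injective h) (by decide)
  generalize σ⁻¹ 0 = a at *
  generalize σ⁻¹ 1 = b at *
  generalize σ⁻¹ 2 = c at *
  fin_cases a <;> fin_cases b <;> fin_cases c <;>
    first
      | exact absurd rfl h01
      | exact absurd rfl h02
      | exact absurd rfl h12
      | rfl
      | (dsimp; ring)

/-- A point of a triangle is determined by its distances to the vertices. -/
theorem eq_of_sqDist_vertex {m : OrientedModuli} {s t : BarySimplex}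
    (h : ∀ i, sqDist m s (BarySimplex.vertex i) = sqDist m t (BarySimplex.vertex i)) : s = t := by
  refine eq_of_sqDist_eq_zero (m := m) ?_
  -- The difference of the squared distances from `s` and `t` to a point is an affine function of
  -- that point. Pairing its values at the vertices with the weights `s - t`, of total zero, leaves
  -- minus twice the squared length of `s - t`.
  have key : 2 * sqDist m s t = -∑ i, (s.1 i - t.1 i) *
      (sqDist m s (BarySimplex.vertex i) - sqDist m t (BarySimplex.vertex i)) := by
    have hs : s.1 2 = 1 - s.1 0 - s.1 1 := by linarith [s.2.2]
    have ht : t.1 2 = 1 - t.1 0 - t.1 1 := by linarith [t.2.2]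
    simp [Fin.sum_univ_three, sqDist, BarySimplex.vertex_val, hs, ht]
    ring
  simp only [h, sub_self, mul_zero, Finset.sum_const_zero, neg_zero] at key
  linarith

/-- Barycentric coordinates are affine, so the area of three points is that of the whole triangle
times `|det s|`; `heronSq` is a multiple of the squared area. -/
theorem heronSq_sqDist (m : OrientedModuli) (s : Fin 3 → BarySimplex) :
    heronSq (sqDist m (s 0) (s 1)) (sqDist m (s 0) (s 2)) (sqDist m (s 1) (s 2)) =
      BarySimplex.det s ^ 2 * heronSq (m.1 0 ^ 2) (m.1 1 ^ 2) (m.1 2 ^ 2) := by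
  have h0 : (s 0).1 2 = 1 - (s 0).1 0 - (s 0).1 1 := by linarith [(s 0).2.2]
  have h1 : (s 1).1 2 = 1 - (s 1).1 0 - (s 1).1 1 := by linarith [(s 1).2.2]
  have h2 : (s 2).1 2 = 1 - (s 2).1 0 - (s 2).1 1 := by linarith [(s 2).2.2]
  simp only [heronSq, sqDist, BarySimplex.det, h0, h1, h2]
  ring

theorem sqDist_vertex (m : OrientedModuli) (i : Fin 3) :
    sqDist m (BarySimplex.vertex (i + 1)) (BarySimplex.vertex (i + 2)) = m.1 i ^ 2 := by
  fin_cases i <;> simp [sqDist, BarySimplex.vertex_val]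

/-! ### Triangles in the Euclidean plane -/

/-- The edge lengths of a triangle. -/
noncomputable def ofTriangle (Δ : Affine.Triangle ℝ (EuclideanSpace ℝ (Fin 2))) :
    OrientedModuli :=
  ⟨fun i => dist (Δ.points (i + 1)) (Δ.points (i + 2)), by
    have hne : ∀ i j, i ≠ j → 0 < dist (Δ.points i) (Δ.points j) := fun i j hij =>
      dist_pos.2 fun h => hij (Δ.independent.injective h)
    have hnc : ∀ i j k : Fin 3, i ≠ j → i ≠ k → j ≠ k →
        dist (Δ.points i) (Δ.points k) < dist (Δ.points i) (Δ.points j)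
          + dist (Δ.points j) (Δ.points k) := by
      intro i j k hij hik hjk
      refine lt_of_le_of_ne (dist_triangle _ _ _) fun h => ?_
      have hw : Wbtw ℝ (Δ.points i) (Δ.points j) (Δ.points k) := dist_add_dist_eq_iff.1 h.symm
      exact affineIndependent_iff_not_collinear_of_ne hij hik hjk |>.1 Δ.independent hw.collinear
    have c := fun i j => dist_comm (Δ.points i) (Δ.points j)
    refine ⟨⟨hne 1 2 (by decide), ?_⟩, ⟨hne 2 0 (by decide), ?_⟩, ⟨hne 0 1 (by decide), ?_⟩⟩
    · change dist (Δ.points 1) (Δ.points 2) < dist (Δ.points 2) (Δ.points 0)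
        + dist (Δ.points 0) (Δ.points 1)
      linarith [hnc 1 0 2 (by decide) (by decide) (by decide), c 0 2, c 0 1]
    · change dist (Δ.points 2) (Δ.points 0) < dist (Δ.points 1) (Δ.points 2)
        + dist (Δ.points 0) (Δ.points 1)
      linarith [hnc 2 1 0 (by decide) (by decide) (by decide), c 1 2, c 0 1]
    · change dist (Δ.points 0) (Δ.points 1) < dist (Δ.points 1) (Δ.points 2)
        + dist (Δ.points 2) (Δ.points 0)
      linarith [hnc 0 2 1 (by decide) (by decide) (by decide), c 0 2, c 1 2]⟩

/-- Every point of the moduli space is the triple of edge lengths of a triangle. -/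
theorem exists_ofTriangle (m : OrientedModuli) : ∃ Δ, ofTriangle Δ = m := by
  have hH := m.heronSq_pos
  obtain ⟨m, ⟨h1, h2⟩, ⟨h3, h4⟩, h5, h6⟩ := m
  -- With two vertices at `(0, 0)` and `(m 2, 0)`, the law of cosines gives the abscissa `x` of the
  -- third. Positivity of `heronSq` makes its height real.
  let x := (m 1 ^ 2 + m 2 ^ 2 - m 0 ^ 2) / (2 * m 2)
  have hx : 2 * m 2 * x = m 1 ^ 2 + m 2 ^ 2 - m 0 ^ 2 := by
    dsimp only [x]
    field_simp
  have hy : 0 ≤ m 1 ^ 2 - x ^ 2 := by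
    have h : 0 ≤ (4 * m 2 ^ 2) * (m 1 ^ 2 - x ^ 2) := by
      have e : (4 * m 2 ^ 2) * (m 1 ^ 2 - x ^ 2) = 4 * m 2 ^ 2 * m 1 ^ 2 - (2 * m 2 * x) ^ 2 := by
        ring
      rw [e, hx]
      refine hH.le.trans (le_of_eq ?_)
      unfold heronSq
      ring
    exact nonneg_of_mul_nonneg_right h (by positivity)
  let y := √(m 1 ^ 2 - x ^ 2)
  have hyy : y ^ 2 = m 1 ^ 2 - x ^ 2 := Real.sq_sqrt hy
  let P : Fin 3 → EuclideanSpace ℝ (Fin 2) := ![!₂[0, 0], !₂[m 2, 0], !₂[x, y]]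
  have d01 : dist (P 0) (P 1) = m 2 := by
    rw [EuclideanSpace.dist_eq]
    simp [P, Real.dist_eq, Real.sqrt_sq h5.le]
  have d20 : dist (P 2) (P 0) = m 1 := by
    rw [EuclideanSpace.dist_eq]
    simp [P, Real.dist_eq, hyy, Real.sqrt_sq h3.le]
  have d12 : dist (P 1) (P 2) = m 0 := by
    rw [EuclideanSpace.dist_eq]
    simp only [P, Real.dist_eq, Fin.sum_univ_two, sq_abs]
    simp
    rw [hyy, Real.sqrt_eq_iff_mul_self_eq (by nlinarith [sq_nonneg (m 0)]) h1.le]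
    linarith
  have hind : AffineIndependent ℝ P := by
    rw [affineIndependent_iff_not_collinear_of_ne (i₁ := 0) (i₂ := 1) (i₃ := 2) (by decide)
      (by decide) (by decide)]
    intro hc
    have c := fun i j => dist_comm (P i) (P j)
    rcases hc.wbtw_or_wbtw_or_wbtw with h | h | h
    · linarith [h.dist_add_dist, c 0 2]
    · linarith [h.dist_add_dist, c 0 1]
    · linarith [h.dist_add_dist, c 1 2]
  refine ⟨⟨P, hind⟩, Subtype.ext (funext fun i => ?_)⟩
  fin_cases i
  exacts [d12, d20, d01]

theorem sq_dist_affineCombination (Δ : Affine.Triangle ℝ (EuclideanSpace ℝ (Fin 2)))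
    (s t : BarySimplex) :
    dist (Finset.univ.affineCombination ℝ Δ.points s.1)
      (Finset.univ.affineCombination ℝ Δ.points t.1) = √(sqDist (ofTriangle Δ) s t) := by
  have hs : ∑ i, s.1 i = 1 := by rw [Fin.sum_univ_three, s.2.2]
  have ht : ∑ i, t.1 i = 1 := by rw [Fin.sum_univ_three, t.2.2]
  let P : Fin 3 → EuclideanSpace ℝ (Fin 2) := Δ.points
  have h := EuclideanGeometry.dist_affineCombination P hs ht
  dsimp only at h
  refine (Real.sqrt_eq_iff_mul_self_eq (sqDist_nonneg _ _ _) dist_nonneg).2 (Eq.trans ?_ h.symm)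
    |>.symm
  have c := fun i j => dist_comm (P i) (P j)
  change -((s.1 1 - t.1 1) * (s.1 2 - t.1 2) * dist (P 1) (P 2) ^ 2
    + (s.1 0 - t.1 0) * (s.1 2 - t.1 2) * dist (P 2) (P 0) ^ 2
    + (s.1 0 - t.1 0) * (s.1 1 - t.1 1) * dist (P 0) (P 1) ^ 2) = _
  simp only [Fin.sum_univ_three, Pi.sub_apply, dist_self, c 1 0, c 2 1, c 2 0]
  ring

/-- Barycentric coordinates identify the simplex with a triangle. -/
noncomputable def equivClosedInterior (Δ : Affine.Triangle ℝ (EuclideanSpace ℝ (Fin 2))) :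
    BarySimplex ≃ Δ.closedInterior :=
  Equiv.ofBijective
    (fun s => ⟨Finset.univ.affineCombination ℝ Δ.points s.1, by
      have hs : ∑ i, s.1 i = 1 := by rw [Fin.sum_univ_three, s.2.2]
      refine (Affine.Simplex.affineCombination_mem_closedInterior_iff hs).2 fun i => ⟨s.2.1 i, ?_⟩
      exact (Finset.single_le_sum (fun j _ => s.2.1 j) (Finset.mem_univ i)).trans hs.le⟩) <| by
    refine ⟨fun s t h => ?_, fun ⟨p, w, hw, hI, hp⟩ => ?_⟩
    · have h' := sq_dist_affineCombination Δ s t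
      rw [dist_eq_zero.2 (Subtype.ext_iff.1 h)] at h'
      exact eq_of_sqDist_eq_zero ((Real.sqrt_eq_zero (sqDist_nonneg _ _ _)).1 h'.symm)
    · exact ⟨⟨w, fun i => (hI i).1, by rw [← hw, Fin.sum_univ_three]⟩, Subtype.ext hp⟩

theorem dist_equivClosedInterior (Δ : Affine.Triangle ℝ (EuclideanSpace ℝ (Fin 2)))
    (s t : BarySimplex) : dist (equivClosedInterior Δ s) (equivClosedInterior Δ t) =
      √(sqDist (ofTriangle Δ) s t) :=
  sq_dist_affineCombination Δ s t

end OrientedModuli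

/-! ### The vertices of a family of triangles -/

namespace TriangleFamily

open BarySimplex OrientedModuli

section Fiber

variable (F : TriangleFamily.{u})

open Classical in
/-- The distance of two points of a family of triangles, with value zero on points of different
fibers. -/
noncomputable def fdist (a b : F.total) : ℝ :=
  if h : F.proj a = F.proj b then F.dist ⟨(a, b), h⟩ else 0

variable {F}

theorem fdist_eq {a b : F.total} (h : F.proj a = F.proj b) : F.fdist a b = F.dist ⟨(a, b), h⟩ :=
  dif_pos h

theorem tendsto_fdist {Z : Type*} {l : Filter Z} {f g : Z → F.total} {a b : F.total}
    (h : ∀ z, F.proj (f z) = F.proj (g z)) (hab : F.proj a = F.proj b)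
    (hf : Tendsto f l (𝓝 a)) (hg : Tendsto g l (𝓝 b)) :
    Tendsto (fun z => F.fdist (f z) (g z)) l (𝓝 (F.fdist a b)) := by
  simp only [fdist_eq hab, fdist_eq (h _)]
  refine (F.continuous_dist.tendsto ⟨(a, b), hab⟩).comp ?_
  rw [tendsto_subtype_rng]
  exact hf.prodMk_nhds hg

variable (F) in
/-- A parametrization of the fiber over `x` by barycentric coordinates, where `m` is the triple of
edge lengths. -/
structure IsChart (x : F.base) (m : OrientedModuli) (c : BarySimplex → F.total) : Prop where
  proj_eq : ∀ s, F.proj (c s) = x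
  exists_eq : ∀ a, F.proj a = x → ∃ s, c s = a
  fdist_eq : ∀ s t, F.fdist (c s) (c t) = √(sqDist m s t)

theorem exists_isChart (x : F.base) : ∃ m c, F.IsChart x m c := by
  obtain ⟨Δ, e, he⟩ := F.isTriangle x
  refine ⟨ofTriangle Δ, fun s => (e.symm (equivClosedInterior Δ s)).1, fun s => ?_,
    fun a ha => ?_, fun s t => ?_⟩
  · exact (e.symm (equivClosedInterior Δ s)).2
  · refine ⟨(equivClosedInterior Δ).symm (e ⟨a, ha⟩), ?_⟩
    simp
  · rw [fdist_eq ((e.symm (equivClosedInterior Δ s)).2.trans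
      (e.symm (equivClosedInterior Δ t)).2.symm), he]
    simp [dist_equivClosedInterior]

namespace IsChart

variable {x : F.base} {m : OrientedModuli} {c : BarySimplex → F.total}

theorem sq_fdist (hc : F.IsChart x m c) (s t : BarySimplex) :
    F.fdist (c s) (c t) ^ 2 = sqDist m s t := by
  rw [hc.fdist_eq, Real.sq_sqrt (sqDist_nonneg _ _ _)]

theorem injective (hc : F.IsChart x m c) : Function.Injective c := by
  intro s t h
  have h1 := hc.sq_fdist s t
  have h2 := hc.sq_fdist t t
  rw [← h] at h2
  rw [← h, h2, sqDist_self] at h1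
  exact eq_of_sqDist_eq_zero h1.symm

theorem permute (hc : F.IsChart x m c) (σ : Equiv.Perm (Fin 3)) :
    F.IsChart x (σ⁻¹ • m) fun s => c (σ • s) where
  proj_eq _ := hc.proj_eq _
  exists_eq a ha := by
    obtain ⟨s, rfl⟩ := hc.exists_eq a ha
    exact ⟨σ⁻¹ • s, by rw [smul_inv_smul]⟩
  fdist_eq s t := by
    rw [hc.fdist_eq, ← sqDist_smul σ (σ⁻¹ • m) s t, smul_inv_smul]

end IsChart

theorem fdist_self (a : F.total) : F.fdist a a = 0 := by
  obtain ⟨m, c, hc⟩ := F.exists_isChart (F.proj a)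
  obtain ⟨s, rfl⟩ := hc.exists_eq a rfl
  rw [hc.fdist_eq, sqDist_self, Real.sqrt_zero]

theorem eq_of_fdist_eq_zero {a b : F.total} (hab : F.proj a = F.proj b) (h : F.fdist a b = 0) :
    a = b := by
  obtain ⟨m, c, hc⟩ := F.exists_isChart (F.proj b)
  obtain ⟨s, rfl⟩ := hc.exists_eq a hab
  obtain ⟨t, rfl⟩ := hc.exists_eq b rfl
  have h2 := hc.sq_fdist s t
  rw [h] at h2
  rw [eq_of_sqDist_eq_zero (m := m) (s := s) (t := t) (by linarith)]

/-- Two limits in one fiber have distance equal to the limit of the distances of points to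
themselves, which is zero. -/
theorem isSeparatedMap_proj : IsSeparatedMap F.proj := by
  refine isSeparatedMap_of_ultrafilter fun 𝒰 a b hab ha hb => eq_of_fdist_eq_zero hab ?_
  have h := tendsto_fdist (F := F) (l := 𝒰) (f := fun e => e) (g := fun e => e)
    (fun _ => rfl) hab (tendsto_id'.2 ha) (tendsto_id'.2 hb)
  simp only [fdist_self] at h
  exact (tendsto_nhds_unique h tendsto_const_nhds)

variable (F) in
/-- Sixteen times the squared area of the triangle with the given vertices. -/
noncomputable def heron (v : Fin 3 → F.total) : ℝ :=
  heronSq (F.fdist (v 0) (v 1) ^ 2) (F.fdist (v 0) (v 2) ^ 2) (F.fdist (v 1) (v 2) ^ 2)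

theorem tendsto_heron {Z : Type*} {l : Filter Z} {f : Z → Fin 3 → F.total} {v : Fin 3 → F.total}
    (h : ∀ z i, F.proj (f z i) = F.proj (f z 0)) (hv : ∀ i, F.proj (v i) = F.proj (v 0))
    (hf : ∀ i, Tendsto (fun z => f z i) l (𝓝 (v i))) :
    Tendsto (fun z => F.heron (f z)) l (𝓝 (F.heron v)) := by
  have hd : ∀ i j, Tendsto (fun z => F.fdist (f z i) (f z j)) l (𝓝 (F.fdist (v i) (v j))) :=
    fun i j => tendsto_fdist (fun z => (h z i).trans (h z j).symm)
      ((hv i).trans (hv j).symm) (hf i) (hf j)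
  have hd' : ∀ i j, Tendsto (fun z => F.fdist (f z i) (f z j) ^ 2) l
      (𝓝 (F.fdist (v i) (v j) ^ 2)) := fun i j => (hd i j).pow 2
  unfold heron heronSq
  exact ((tendsto_const_nhds.mul (hd' 0 1)).mul (hd' 0 2)).sub
    ((((hd' 0 1).add (hd' 0 2)).sub (hd' 1 2)).pow 2)

variable (F) in
/-- A triple of points of a fiber consists of the three vertices if and only if it maximizes the
area among the triples of points of that fiber. -/
structure IsVertices (v : Fin 3 → F.total) : Prop where
  proj_eq : ∀ i, F.proj (v i) = F.proj (v 0)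
  heron_le : ∀ w : Fin 3 → F.total, (∀ i, F.proj (w i) = F.proj (v 0)) → F.heron w ≤ F.heron v

namespace IsChart

variable {x : F.base} {m : OrientedModuli} {c : BarySimplex → F.total}

theorem heron_eq (hc : F.IsChart x m c) (s : Fin 3 → BarySimplex) :
    F.heron (fun i => c (s i)) =
      BarySimplex.det s ^ 2 * heronSq (m.1 0 ^ 2) (m.1 1 ^ 2) (m.1 2 ^ 2) := by
  rw [heron, hc.sq_fdist, hc.sq_fdist, hc.sq_fdist, heronSq_sqDist]

theorem exists_coords (hc : F.IsChart x m c) {w : Fin 3 → F.total} (hw : ∀ i, F.proj (w i) = x) :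
    ∃ s : Fin 3 → BarySimplex, w = fun i => c (s i) := by
  choose s hs using fun i => hc.exists_eq (w i) (hw i)
  exact ⟨s, funext fun i => (hs i).symm⟩

theorem isVertices (hc : F.IsChart x m c) : F.IsVertices fun i => c (vertex i) where
  proj_eq i := by rw [hc.proj_eq, hc.proj_eq]
  heron_le w hw := by
    simp only [hc.proj_eq] at hw
    obtain ⟨s, rfl⟩ := hc.exists_coords hw
    have h1 : BarySimplex.det vertex ^ 2 = 1 := det_vertex_sq 1
    rw [hc.heron_eq, hc.heron_eq vertex, h1]
    exact mul_le_mul_of_nonneg_right (det_sq_le_one s) m.heronSq_pos.le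

/-- Comparison with the vertices of the chart and cancellation of the positive area bound the
squared determinant of the coordinates below by one. -/
theorem exists_perm (hc : F.IsChart x m c) {v : Fin 3 → F.total} (hv : F.IsVertices v)
    (hx : F.proj (v 0) = x) : ∃ σ : Equiv.Perm (Fin 3), ∀ i, v i = c (vertex (σ i)) := by
  obtain ⟨s, rfl⟩ := hc.exists_coords fun i => (hv.proj_eq i).trans hx
  have h := hv.heron_le (fun i => c (vertex i)) fun i => by rw [hc.proj_eq, hc.proj_eq]
  have h1 : BarySimplex.det vertex ^ 2 = 1 := det_vertex_sq 1
  rw [hc.heron_eq vertex, hc.heron_eq s, h1] at h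
  obtain ⟨σ, hσ⟩ := exists_perm_of_one_le_det_sq (le_of_mul_le_mul_right h m.heronSq_pos)
  exact ⟨σ, fun i => congrArg c (hσ i)⟩

end IsChart

namespace IsVertices

variable {v w : Fin 3 → F.total}

/-- The vertices of any chart agree with `v` up to a permutation, which is absorbed by relabelling
the chart. -/
theorem exists_chart (hv : F.IsVertices v) :
    ∃ m c, F.IsChart (F.proj (v 0)) m c ∧ ∀ i, c (vertex i) = v i := by
  obtain ⟨m, c, hc⟩ := F.exists_isChart (F.proj (v 0))
  obtain ⟨σ, hσ⟩ := hc.exists_perm hv rfl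
  exact ⟨_, _, hc.permute σ, fun i => by rw [smul_vertex, hσ]⟩

theorem comp_perm (hv : F.IsVertices v) (σ : Equiv.Perm (Fin 3)) :
    F.IsVertices fun i => v (σ i) := by
  obtain ⟨m, c, hc, hcv⟩ := hv.exists_chart
  have h := (hc.permute σ).isVertices
  simp only [smul_vertex, hcv] at h
  exact h

theorem injective (hv : F.IsVertices v) : Function.Injective v := by
  obtain ⟨m, c, hc, hcv⟩ := hv.exists_chart
  rw [← funext hcv]
  exact hc.injective.comp vertex_injective

theorem exists_perm (hv : F.IsVertices v) (hw : F.IsVertices w)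
    (h : F.proj (v 0) = F.proj (w 0)) : ∃ σ : Equiv.Perm (Fin 3), ∀ i, w i = v (σ i) := by
  obtain ⟨m, c, hc, hcv⟩ := hv.exists_chart
  obtain ⟨σ, hσ⟩ := hc.exists_perm hw h.symm
  exact ⟨σ, fun i => by rw [hσ, hcv]⟩

/-- A point of a fiber is determined by its distances to the vertices. -/
theorem eq_of_fdist_eq (hv : F.IsVertices v) {a b : F.total} (ha : F.proj a = F.proj (v 0))
    (hb : F.proj b = F.proj (v 0)) (h : ∀ i, F.fdist a (v i) = F.fdist b (v i)) : a = b := by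
  obtain ⟨m, c, hc, hcv⟩ := hv.exists_chart
  obtain ⟨s, rfl⟩ := hc.exists_eq a ha
  obtain ⟨t, rfl⟩ := hc.exists_eq b hb
  rw [eq_of_sqDist_vertex (m := m) (s := s) (t := t)]
  intro i
  rw [← hc.sq_fdist, ← hc.sq_fdist, hcv, h]

end IsVertices

variable (F) in
theorem exists_isVertices (x : F.base) : ∃ v, F.IsVertices v ∧ F.proj (v 0) = x := by
  obtain ⟨m, c, hc⟩ := F.exists_isChart x
  exact ⟨_, hc.isVertices, hc.proj_eq _⟩

theorem IsChart.edge_eq {x : F.base} {m : OrientedModuli} {c : BarySimplex → F.total}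
    (hc : F.IsChart x m c) (i : Fin 3) :
    F.fdist (c (vertex (i + 1))) (c (vertex (i + 2))) = m.1 i := by
  rw [hc.fdist_eq, sqDist_vertex, Real.sqrt_sq]
  fin_cases i
  exacts [m.2.1.1.le, m.2.2.1.1.le, m.2.2.2.1.le]

/-- The edge lengths of a fiber with labelled vertices. -/
noncomputable def edges (v : {v : Fin 3 → F.total // F.IsVertices v}) : OrientedModuli :=
  ⟨fun i => F.fdist (v.1 (i + 1)) (v.1 (i + 2)), by
    obtain ⟨m, c, hc, hcv⟩ := v.2.exists_chart
    simp only [← hcv, hc.edge_eq]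
    exact m.2⟩

theorem IsChart.edges_eq {x : F.base} {m : OrientedModuli} {c : BarySimplex → F.total}
    (hc : F.IsChart x m c) (v : {v : Fin 3 → F.total // F.IsVertices v})
    (hcv : ∀ i, c (vertex i) = v.1 i) : edges v = m := by
  apply Subtype.ext
  funext i
  change F.fdist (v.1 (i + 1)) (v.1 (i + 2)) = m.1 i
  rw [← hcv, ← hcv, hc.edge_eq]

theorem exists_chart (v : {v : Fin 3 → F.total // F.IsVertices v}) :
    ∃ c, F.IsChart (F.proj (v.1 0)) (edges v) c ∧ ∀ i, c (vertex i) = v.1 i := by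
  obtain ⟨m, c, hc, hcv⟩ := v.2.exists_chart
  obtain rfl := hc.edges_eq v hcv
  exact ⟨c, hc, hcv⟩

end Fiber

/-! ### The bundle of vertices -/

section VertexBundle

variable (F : TriangleFamily.{u})

/-- The space of triples of labelled vertices of the fibers. -/
abbrev VertexSpace : Type u := {v : Fin 3 → F.total // F.IsVertices v}

variable {F}

/-- The projection of the space of labelled vertices. -/
def vertexProj (v : F.VertexSpace) : F.base := F.proj (v.1 0)

theorem continuous_vertexProj : Continuous (vertexProj (F := F)) :=
  F.proj.hom.continuous.comp ((continuous_apply 0).comp continuous_subtype_val)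

theorem continuous_edges : Continuous (edges (F := F)) := by
  refine Continuous.subtype_mk (continuous_pi fun i => ?_) _
  rw [continuous_iff_continuousAt]
  intro v
  have hc : ∀ i, Continuous fun v : F.VertexSpace => v.1 i := fun i =>
    (continuous_apply i).comp continuous_subtype_val
  exact tendsto_fdist (fun z => (z.2.proj_eq _).trans (z.2.proj_eq _).symm)
    ((v.2.proj_eq _).trans (v.2.proj_eq _).symm) ((hc _).tendsto v) ((hc _).tendsto v)

theorem isSeparatedMap_vertexProj : IsSeparatedMap (vertexProj (F := F)) := by
  refine isSeparatedMap_of_ultrafilter fun 𝒰 v w hvw hv hw => Subtype.ext (funext fun i => ?_)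
  have hc : Continuous fun v : F.VertexSpace => v.1 i :=
    (continuous_apply i).comp continuous_subtype_val
  refine isSeparatedMap_proj.eq_of_ultrafilter_le (𝒰 := 𝒰.map fun v : F.VertexSpace => v.1 i) ?_
    ((hc.tendsto v).mono_left hv) ((hc.tendsto w).mono_left hw)
  rw [v.2.proj_eq, w.2.proj_eq]
  exact hvw

/-- Limits of vertices are vertices. -/
theorem isVertices_of_tendsto {Z : Type*} {l : Filter Z} [l.NeBot] {f : Z → Fin 3 → F.total}
    {v : Fin 3 → F.total} (hf : ∀ z, F.IsVertices (f z))
    (hv : ∀ i, F.proj (v i) = F.proj (v 0)) (h : ∀ i, Tendsto (fun z => f z i) l (𝓝 (v i))) :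
    F.IsVertices v := by
  refine ⟨hv, fun w hw => ?_⟩
  obtain ⟨T, _, hT⟩ := F.isFiberBundle
  obtain ⟨t, ht⟩ := hT (F.proj (v 0))
  have hpf : Tendsto (fun z => F.proj (f z 0)) l (𝓝 (F.proj (v 0))) :=
    (F.proj.hom.continuous.tendsto _).comp (h 0)
  have hev : ∀ᶠ z in l, F.proj (f z 0) ∈ t.baseSet := hpf.eventually (t.open_baseSet.mem_nhds ht)
  classical
  -- The competitor `w` is moved to nearby fibers with constant fiber coordinate. The default `f z`
  -- keeps `g z` in the fiber of `f z` for every `z`, so the area inequality holds throughout and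
  -- passes to the limit.
  let g : Z → Fin 3 → F.total := fun z i =>
    if F.proj (f z 0) ∈ t.baseSet then t.toPartialEquiv.symm (F.proj (f z 0), (t (w i)).2)
    else f z i
  have hgp : ∀ z i, F.proj (g z i) = F.proj (f z 0) := by
    intro z i
    dsimp only [g]
    split_ifs with hz
    · exact t.proj_symm_apply' hz
    · exact (hf z).proj_eq i
  have hg : ∀ i, Tendsto (fun z => g z i) l (𝓝 (w i)) := by
    intro i
    have hwi : w i ∈ t.source := t.mem_source.2 (by rw [hw]; exact ht)
    have htgt : (F.proj (v 0), (t (w i)).2) ∈ t.target := t.mem_target.2 ht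
    have h1 : Tendsto (fun z => (F.proj (f z 0), (t (w i)).2)) l
        (𝓝 (F.proj (v 0), (t (w i)).2)) := hpf.prodMk_nhds tendsto_const_nhds
    have h2 := (t.toOpenPartialHomeomorph.continuousAt_symm htgt).tendsto.comp h1
    have h3 : t.toOpenPartialHomeomorph.symm (F.proj (v 0), (t (w i)).2) = w i := by
      rw [← hw i]
      exact t.symm_apply_mk_proj hwi
    rw [h3] at h2
    refine h2.congr' ?_
    filter_upwards [hev] with z hz
    dsimp only [g]
    rw [if_pos hz]
    rfl
  have hlim_g := tendsto_heron (fun z i => (hgp z i).trans (hgp z 0).symm)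
    (fun i => (hw i).trans (hw 0).symm) hg
  have hlim_f := tendsto_heron (fun z i => (hf z).proj_eq i) hv h
  exact le_of_tendsto_of_tendsto' hlim_g hlim_f fun z => (hf z).heron_le _ (hgp z)

/-- Properness of the family gives a limit of each vertex separately, and the three limits again
form a triple of vertices. -/
theorem isProperMap_vertexProj : IsProperMap (vertexProj (F := F)) := by
  refine isProperMap_iff_ultrafilter.2 ⟨continuous_vertexProj, fun 𝒰 x h𝒰 => ?_⟩
  have h : ∀ i : Fin 3, ∃ a, F.proj a = x ∧ Tendsto (fun v : F.VertexSpace => v.1 i) 𝒰 (𝓝 a) := by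
    intro i
    refine F.isProper.exists_tendsto (h𝒰.congr fun v => ?_)
    exact (v.2.proj_eq i).symm
  choose a ha hta using h
  have hv : F.IsVertices a := isVertices_of_tendsto (l := (𝒰 : Filter F.VertexSpace))
    (f := fun v => v.1) (fun v => v.2) (fun i => (ha i).trans (ha 0).symm) hta
  refine ⟨⟨a, hv⟩, ha 0, ?_⟩
  have : Tendsto (fun v : F.VertexSpace => v) 𝒰 (𝓝 ⟨a, hv⟩) :=
    tendsto_subtype_rng.2 (tendsto_pi_nhds.2 hta)
  exact this

/-- The symmetric group permutes the labels. -/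
instance : MulAction (Equiv.Perm (Fin 3))ᵐᵒᵖ F.VertexSpace where
  smul σ v := ⟨fun i => v.1 (σ.unop i), v.2.comp_perm σ.unop⟩
  one_smul _ := rfl
  mul_smul _ _ _ := rfl

theorem op_smul_val (σ : Equiv.Perm (Fin 3)) (v : F.VertexSpace) (i : Fin 3) :
    (MulOpposite.op σ • v).1 i = v.1 (σ i) := rfl

instance : DiscreteTopology (Equiv.Perm (Fin 3))ᵐᵒᵖ :=
  MulOpposite.opHomeomorph.symm.isEmbedding.discreteTopology

instance : ContinuousSMul (Equiv.Perm (Fin 3))ᵐᵒᵖ F.VertexSpace where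
  continuous_smul := by
    refine continuous_prod_of_discrete_left.mpr fun σ => ?_
    have h : Continuous fun v : F.VertexSpace => v.1 := continuous_subtype_val
    exact Continuous.subtype_mk
      (continuous_pi fun i => (continuous_apply (σ.unop i)).comp h) fun v => v.2.comp_perm σ.unop

theorem vertexProj_smul (σ : Equiv.Perm (Fin 3)) (v : F.VertexSpace) :
    vertexProj (MulOpposite.op σ • v) = vertexProj v :=
  v.2.proj_eq _

theorem exists_op_smul_eq (v w : F.VertexSpace) (h : vertexProj v = vertexProj w) :
    ∃ σ : Equiv.Perm (Fin 3), MulOpposite.op σ • v = w := by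
  obtain ⟨σ, hσ⟩ := v.2.exists_perm w.2 h
  exact ⟨σ, Subtype.ext (funext fun i => (hσ i).symm)⟩

theorem eq_one_of_op_smul_eq (v : F.VertexSpace) (σ : Equiv.Perm (Fin 3))
    (h : MulOpposite.op σ • v = v) : σ = 1 :=
  Equiv.ext fun i => v.2.injective (congrFun (congrArg Subtype.val h) i)

theorem edges_smul (σ : Equiv.Perm (Fin 3)) (v : F.VertexSpace) :
    edges (MulOpposite.op σ • v) = σ⁻¹ • edges v := by
  obtain ⟨c, hc, hcv⟩ := exists_chart v
  exact (hc.permute σ).edges_eq _ fun i => by rw [smul_vertex, hcv, op_smul_val]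

variable (F) in
/-- The principal bundle of labellings of the vertices of a family of triangles, with the map to the
moduli space of oriented triangles. -/
noncomputable def vertexBundle : QuotientStack.{u} (Equiv.Perm (Fin 3)) OrientedModuli where
  base := F.base
  total := TopCat.of F.VertexSpace
  proj := TopCat.ofHom ⟨vertexProj, continuous_vertexProj⟩
  mulAction := inferInstanceAs (MulAction _ F.VertexSpace)
  continuousSMul := inferInstanceAs (ContinuousSMul _ F.VertexSpace)
  proj_smul := vertexProj_smul
  locallyTrivial x := exists_equivariant_trivialization (E := F.VertexSpace) isProperMap_vertexProj
    isSeparatedMap_vertexProj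
    (fun x => by
      obtain ⟨v, hv, hx⟩ := F.exists_isVertices x
      exact ⟨⟨v, hv⟩, hx⟩)
    vertexProj_smul exists_op_smul_eq eq_one_of_op_smul_eq x
  toSpace := ⟨edges, continuous_edges⟩
  toSpace_smul := edges_smul

end VertexBundle

/-! ### Functoriality -/

namespace Hom

variable {F F' : TriangleFamily.{u}} (f : Hom F F')

theorem fdist_total {a b : F.total} (h : F.proj a = F.proj b) :
    F'.fdist (f.total a) (f.total b) = F.fdist a b := by
  rw [fdist_eq h, fdist_eq (by rw [f.comm, f.comm, h]), f.isometry]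

theorem heron_total {v : Fin 3 → F.total} (h : ∀ i, F.proj (v i) = F.proj (v 0)) :
    F'.heron (fun i => f.total (v i)) = F.heron v := by
  have h' : ∀ i j, F.proj (v i) = F.proj (v j) := fun i j => (h i).trans (h j).symm
  simp only [heron, f.fdist_total (h' _ _)]

/-- Areas depend only on distances, and every competing triple in the target fiber is an image by
fiberwise surjectivity. -/
theorem isVertices_total {v : Fin 3 → F.total} (hv : F.IsVertices v) :
    F'.IsVertices fun i => f.total (v i) where
  proj_eq i := by rw [f.comm, f.comm, hv.proj_eq]
  heron_le w hw := by
    simp only [f.comm] at hw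
    choose u hu huw using fun i => (f.bijOn (F.proj (v 0))).surjOn (hw i)
    obtain rfl : (fun i => f.total (u i)) = w := funext huw
    have hu' : ∀ i, F.proj (u i) = F.proj (v 0) := hu
    rw [f.heron_total hv.proj_eq, f.heron_total fun i => (hu' i).trans (hu' 0).symm]
    exact hv.heron_le u hu'

end Hom

end TriangleFamily

/-! ### Torsor fibers of principal bundles and cartesian squares -/

namespace QuotientStack

variable {G X : Type} [Group G] [TopologicalSpace G] [IsTopologicalGroup G]
  [TopologicalSpace X] [MulAction G X] [ContinuousSMul G X]

open MulOpposite

variable (P : QuotientStack.{u} G X)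

theorem exists_op_smul_eq {e e' : P.total} (h : P.proj e = P.proj e') :
    ∃ g : G, op g • e = e' := by
  obtain ⟨t, ht, htg⟩ := P.locallyTrivial (P.proj e)
  have he : e ∈ t.source := t.mem_source.2 ht
  have he' : e' ∈ t.source := t.mem_source.2 (h ▸ ht)
  have hg : op ((t e).2⁻¹ * (t e').2) • e ∈ t.source :=
    t.mem_source.2 (by rw [P.proj_smul]; exact ht)
  refine ⟨(t e).2⁻¹ * (t e').2, t.injOn hg he' (Prod.ext ?_ ?_)⟩
  · change (t _).1 = (t _).1
    rw [t.coe_fst hg, t.coe_fst he', P.proj_smul, h]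
  · change (t _).2 = (t _).2
    rw [htg e he, mul_inv_cancel_left]

theorem eq_one_of_op_smul_eq {e : P.total} {g : G} (h : op g • e = e) : g = 1 := by
  obtain ⟨t, ht, htg⟩ := P.locallyTrivial (P.proj e)
  have h' := htg e (t.mem_source.2 ht) g
  rw [h] at h'
  exact left_eq_mul.1 h'

theorem proj_surjective : Function.Surjective P.proj := by
  intro y
  obtain ⟨t, ht, -⟩ := P.locallyTrivial y
  exact ⟨_, t.proj_symm_apply' (x := 1) ht⟩

theorem isSeparatedMap_proj [T2Space G] : IsSeparatedMap P.proj :=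
  isSeparatedMap_of_trivialization fun y => (P.locallyTrivial y).imp fun _ h => h.1

theorem isProperMap_proj [CompactSpace G] : IsProperMap P.proj :=
  isProperMap_of_trivialization P.proj.hom.continuous
    fun y => (P.locallyTrivial y).imp fun _ h => h.1

variable {P}

/-- An equivariant map of principal bundles is cartesian. -/
theorem isPullback_of_equivariant [T2Space G] [CompactSpace G] {Q : QuotientStack.{u} G X}
    {t : P.total ⟶ Q.total} {b : P.base ⟶ Q.base} (comm : ∀ e, Q.proj (t e) = b (P.proj e))
    (hsmul : ∀ (g : G) (e : P.total), t (op g • e) = op g • t e) :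
    IsPullback t P.proj Q.proj b := by
  refine TopCat.isPullback_of_bijOn comm P.isProperMap_proj Q.isSeparatedMap_proj fun y =>
    ⟨fun e he => ?_, fun e he e' he' h => ?_, fun q hq => ?_⟩
  · change Q.proj (t e) = b y
    rw [comm, he]
  · obtain ⟨g, rfl⟩ := P.exists_op_smul_eq (he.trans he'.symm)
    rw [hsmul] at h
    rw [Q.eq_one_of_op_smul_eq h.symm, op_one, one_smul]
  · obtain ⟨e, rfl⟩ := P.proj_surjective y
    obtain ⟨g, rfl⟩ := Q.exists_op_smul_eq ((comm e).trans (Eq.symm hq))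
    exact ⟨op g • e, P.proj_smul g e, hsmul g e⟩

end QuotientStack

namespace TriangleFamily

/-- A morphism of families of triangles induces a morphism of the bundles of vertices. -/
noncomputable def vertexBundleMap {F F' : TriangleFamily.{u}} (f : F ⟶ F') :
    F.vertexBundle ⟶ F'.vertexBundle :=
  let t : F.vertexBundle.total ⟶ F'.vertexBundle.total := TopCat.ofHom
    ⟨fun v : F.VertexSpace => (⟨fun i => f.total (v.1 i), f.isVertices_total v.2⟩ : F'.VertexSpace),
      Continuous.subtype_mk (continuous_pi fun i => f.total.hom.continuous.comp
        ((continuous_apply i).comp continuous_subtype_val)) _⟩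
  { base := f.base
    total := t
    isPullback := QuotientStack.isPullback_of_equivariant (P := F.vertexBundle)
      (Q := F'.vertexBundle) (t := t) (fun v => f.comm _) (fun _ _ => rfl)
    map_smul := fun _ _ => rfl
    toSpace_comp := fun v => by
      apply Subtype.ext
      funext i
      exact f.fdist_total ((v.2.proj_eq _).trans (v.2.proj_eq _).symm) }

/-- The functor sending a family of triangles to the bundle of labellings of its vertices. -/
noncomputable def vertexFunctor :
    TriangleFamily.{u} ⥤ QuotientStack.{u} (Equiv.Perm (Fin 3)) OrientedModuli where
  obj F := F.vertexBundle
  map f := vertexBundleMap f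

/-- The functor sending a family of triangles to the bundle of labellings of its vertices, over the
category of topological spaces. -/
noncomputable def vertexBasedFunctor : BasedFunctor triangleFamilies.{u}
    (quotientStack.{u} (Equiv.Perm (Fin 3)) OrientedModuli) where
  toFunctor := vertexFunctor
  w := rfl

end TriangleFamily

/-! ### Full faithfulness of the vertex functor -/

namespace TriangleFamily

open BarySimplex OrientedModuli

/-- Morphisms preserve distances to the vertices, and these determine a point; agreement on vertices
is therefore agreement everywhere. -/
instance : vertexFunctor.{u}.Faithful where
  map_injective {F F'} f g h := by
    have hb : f.base = g.base := congrArg QuotientStack.Hom.base h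
    have ht : (vertexBundleMap f).total = (vertexBundleMap g).total :=
      congrArg QuotientStack.Hom.total h
    refine Hom.ext hb ?_
    ext a
    obtain ⟨v, hv, hx⟩ := F.exists_isVertices (F.proj a)
    let v' : F.VertexSpace := ⟨v, hv⟩
    have hv' : (vertexBundleMap f).total v' = (vertexBundleMap g).total v' := by rw [ht]
    have hvi : ∀ i, f.total (v i) = g.total (v i) := fun i =>
      congrArg (fun w : F'.VertexSpace => w.1 i) hv'
    have hav : ∀ i, F.proj a = F.proj (v i) := fun i => by rw [hv.proj_eq, hx]
    refine (f.isVertices_total hv).eq_of_fdist_eq ?_ ?_ fun i => ?_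
    · rw [f.comm, f.comm, hx]
    · rw [f.comm, g.comm, hx, hb]
    · rw [f.fdist_total (hav i), hvi, g.fdist_total (hav i)]

section Full

variable {F F' : TriangleFamily.{u}} (η : F.vertexBundle ⟶ F'.vertexBundle)

/-- The map of labelled vertices underlying a morphism of the bundles of vertices. -/
noncomputable def vertexMap (v : F.VertexSpace) : F'.VertexSpace := η.total v

theorem continuous_vertexMap : Continuous (vertexMap η) := η.total.hom.continuous

theorem vertexProj_vertexMap (v : F.VertexSpace) :
    vertexProj (vertexMap η v) = η.base (vertexProj v) :=
  ConcreteCategory.congr_hom η.isPullback.w v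

theorem vertexMap_smul (σ : Equiv.Perm (Fin 3)) (v : F.VertexSpace) (i : Fin 3) :
    (vertexMap η (MulOpposite.op σ • v)).1 i = (vertexMap η v).1 (σ i) :=
  congrFun (congrArg Subtype.val (η.map_smul σ v)) i

theorem edges_vertexMap (v : F.VertexSpace) : edges (vertexMap η v) = edges v :=
  η.toSpace_comp v

/-- The points with the same distances to the vertices correspond to each other. -/
def Corresponds (a : F.total) (a' : F'.total) : Prop :=
  F'.proj a' = η.base (F.proj a) ∧ ∀ v : F.VertexSpace, vertexProj v = F.proj a →
    ∀ i, F'.fdist a' ((vertexMap η v).1 i) = F.fdist a (v.1 i)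

/-- A labelling and its image under `η` have equal edge lengths, so the charts adapted to them
induce the same metric on the simplex. Equal barycentric coordinates then give equal distances to
the vertices; other labellings only permute these conditions. -/
theorem exists_charts (x : F.base) : ∃ m c c', F.IsChart x m c ∧ F'.IsChart (η.base x) m c' ∧
    ∀ s, Corresponds η (c s) (c' s) := by
  obtain ⟨v, hv, rfl⟩ := F.exists_isVertices x
  obtain ⟨c, hc, hcv⟩ := exists_chart (F := F) ⟨v, hv⟩
  obtain ⟨c', hc', hcv'⟩ := exists_chart (vertexMap η ⟨v, hv⟩)
  rw [edges_vertexMap] at hc'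
  have hp : F'.proj ((vertexMap η ⟨v, hv⟩).1 0) = η.base (F.proj (v 0)) :=
    vertexProj_vertexMap η ⟨v, hv⟩
  rw [hp] at hc'
  refine ⟨_, c, c', hc, hc', fun s => ⟨?_, fun w hw i => ?_⟩⟩
  · rw [hc'.proj_eq, hc.proj_eq]
  · rw [hc.proj_eq] at hw
    obtain ⟨σ, rfl⟩ := exists_op_smul_eq (F := F) ⟨v, hv⟩ w hw.symm
    rw [vertexMap_smul, op_smul_val, ← hcv', ← hcv, hc.fdist_eq, hc'.fdist_eq]

variable {η}

/-- Only one labelling needs to be tested for `a'`. This matters for limits, where distances are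
controlled along a single convergent choice of labellings. -/
theorem Corresponds.unique {a : F.total} {a' b' : F'.total} (v : F.VertexSpace)
    (hv : vertexProj v = F.proj a) (ha : F'.proj a' = η.base (F.proj a))
    (ha' : ∀ i, F'.fdist a' ((vertexMap η v).1 i) = F.fdist a (v.1 i))
    (h : Corresponds η a b') : a' = b' := by
  have hp : F'.proj ((vertexMap η v).1 0) = η.base (F.proj a) := by
    rw [← hv]
    exact vertexProj_vertexMap η v
  refine (vertexMap η v).2.eq_of_fdist_eq ?_ ?_ fun i => ?_
  · rw [ha, hp]
  · rw [h.1, hp]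
  · rw [ha', h.2 v hv]

variable (η)

theorem exists_corresponds (a : F.total) : ∃ a', Corresponds η a a' := by
  obtain ⟨m, c, c', hc, hc', h⟩ := exists_charts η (F.proj a)
  obtain ⟨s, rfl⟩ := hc.exists_eq a rfl
  exact ⟨_, h s⟩

variable (F) in
theorem exists_vertexProj_eq (x : F.base) : ∃ v : F.VertexSpace, vertexProj v = x := by
  obtain ⟨v, hv, hx⟩ := F.exists_isVertices x
  exact ⟨⟨v, hv⟩, hx⟩

theorem continuous_of_corresponds {g : F.total → F'.total} (hg : ∀ a, Corresponds η a (g a)) :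
    Continuous g := by
  refine F'.isProper.continuous_of_forall_limit ?_ fun a 𝒰 a' h𝒰 ha' hta' => ?_
  · simp only [(hg _).1]
    exact η.base.hom.continuous.comp F.proj.hom.continuous
  -- The labellings are chosen without continuity. Properness of `vertexProj` makes them converge
  -- along the ultrafilter, and the equalities of distances pass to the limit.
  · choose v hv using fun b : F.total => exists_vertexProj_eq F (F.proj b)
    have h1 : Tendsto (fun b => vertexProj (v b)) 𝒰 (𝓝 (F.proj a)) := by
      simp only [hv]
      exact (F.proj.hom.continuous.tendsto a).mono_left h𝒰
    obtain ⟨w, hw, htw⟩ := isProperMap_vertexProj.exists_tendsto h1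
    have ha : F'.proj a' = η.base (F.proj a) := ha'.trans (hg a).1
    refine Corresponds.unique w hw ha (fun i => ?_) (hg a)
    have hval : ∀ {F : TriangleFamily.{u}}, Continuous fun v : F.VertexSpace => v.1 i := fun {F} =>
      (continuous_apply i).comp continuous_subtype_val
    have hvi : ∀ b, F.proj b = F.proj ((v b).1 i) := fun b => by
      rw [(v b).2.proj_eq]
      exact (hv b).symm
    have hwi : F.proj a = F.proj (w.1 i) := by
      rw [w.2.proj_eq]
      exact hw.symm
    have hpv : ∀ v : F.VertexSpace, F'.proj ((vertexMap η v).1 i) = η.base (vertexProj v) :=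
      fun v => ((vertexMap η v).2.proj_eq i).trans (vertexProj_vertexMap η v)
    have hlim : Tendsto (fun b => F.fdist b ((v b).1 i)) 𝒰 (𝓝 (F.fdist a (w.1 i))) :=
      tendsto_fdist hvi hwi (tendsto_id'.2 h𝒰) ((hval.tendsto w).comp htw)
    have hlim' : Tendsto (fun b => F'.fdist (g b) ((vertexMap η (v b)).1 i)) 𝒰
        (𝓝 (F'.fdist a' ((vertexMap η w).1 i))) := by
      refine tendsto_fdist (fun b => ?_) ?_ hta'
        (((hval.comp (continuous_vertexMap η)).tendsto w).comp htw)
      · rw [(hg b).1, hpv, hv]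
      · rw [ha, hpv, hw]
    simp only [(hg _).2 _ (hv _)] at hlim'
    exact tendsto_nhds_unique hlim' hlim

end Full

/-- Matching distances to the vertices defines the map on points. In adapted charts it is the
identity on barycentric coordinates, hence a bijective isometry of fibers. -/
instance : vertexFunctor.{u}.Full where
  map_surjective {F F'} η := by
    change F.vertexBundle ⟶ F'.vertexBundle at η
    choose g hg using exists_corresponds η
    have hchart : ∀ x, ∃ m c c', F.IsChart x m c ∧ F'.IsChart (η.base x) m c' ∧
        ∀ s, g (c s) = c' s := by
      intro x
      obtain ⟨m, c, c', hc, hc', h⟩ := exists_charts η x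
      refine ⟨m, c, c', hc, hc', fun s => ?_⟩
      obtain ⟨v, hv⟩ := exists_vertexProj_eq F (F.proj (c s))
      exact Corresponds.unique v hv (hg _).1 ((hg _).2 v hv) (h s)
    have hdist : ∀ a b, F.proj a = F.proj b → F'.fdist (g a) (g b) = F.fdist a b := by
      intro a b hab
      obtain ⟨m, c, c', hc, hc', h⟩ := hchart (F.proj b)
      obtain ⟨s, rfl⟩ := hc.exists_eq a hab
      obtain ⟨t, rfl⟩ := hc.exists_eq b rfl
      rw [h, h, hc.fdist_eq, hc'.fdist_eq]
    let f : Hom F F' :=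
      { base := η.base
        total := TopCat.ofHom ⟨g, continuous_of_corresponds η hg⟩
        comm := fun a => (hg a).1
        bijOn := fun x => by
          refine ⟨fun a ha => ?_, fun a ha b hb hab => ?_, fun a' ha' => ?_⟩
          · exact (hg a).1.trans (congrArg η.base ha)
          · have hab' : F.proj a = F.proj b := Eq.trans ha (Eq.symm hb)
            refine eq_of_fdist_eq_zero hab' ?_
            rw [← hdist a b hab']
            have hgab : g a = g b := hab
            rw [hgab, fdist_self]
          · obtain ⟨m, c, c', hc, hc', h⟩ := hchart x
            obtain ⟨s, rfl⟩ := hc'.exists_eq a' ha'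
            exact ⟨c s, hc.proj_eq s, h s⟩
        isometry := fun a b hab => by
          have h := hdist a b hab
          rwa [fdist_eq hab, fdist_eq (by rw [(hg a).1, (hg b).1, hab])] at h }
    refine ⟨f, QuotientStack.Hom.ext rfl ?_⟩
    refine TopCat.hom_ext (ContinuousMap.ext fun v : F.VertexSpace => ?_)
    refine Subtype.ext (funext fun i => ?_)
    change g (v.1 i) = (vertexMap η v).1 i
    have hv : ∀ i, F'.proj ((vertexMap η v).1 i) = η.base (F.proj (v.1 0)) := fun i =>
      ((vertexMap η v).2.proj_eq i).trans (vertexProj_vertexMap η v)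
    refine eq_of_fdist_eq_zero ?_ ?_
    · rw [(hg _).1, hv, v.2.proj_eq]
    · rw [(hg _).2 v (v.2.proj_eq i).symm i, fdist_self]

end TriangleFamily

/-! ### The quotient stack is fibered in groupoids -/

namespace QuotientStack

open MulOpposite

variable {G X : Type} [Group G] [TopologicalSpace G] [IsTopologicalGroup G]
  [TopologicalSpace X] [MulAction G X] [ContinuousSMul G X]

theorem Hom.comm {P Q : QuotientStack.{u} G X} (φ : Hom P Q) (e : P.total) :
    Q.proj (φ.total e) = φ.base (P.proj e) :=
  ConcreteCategory.congr_hom φ.isPullback.w e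

theorem Hom.total_inj {P Q : QuotientStack.{u} G X} (φ : Hom P Q) {e e' : P.total}
    (hp : P.proj e = P.proj e') (h : φ.total e = φ.total e') : e = e' := by
  obtain ⟨g, rfl⟩ := P.exists_op_smul_eq hp
  rw [φ.map_smul] at h
  rw [Q.eq_one_of_op_smul_eq h.symm, op_one, one_smul]

/-- The upper map of the factorization is the one given by the cartesian square. It is equivariant
because `φ` is injective on fibers. -/
theorem isStronglyCartesian [T2Space G] [CompactSpace G] {P Q : QuotientStack.{u} G X} (φ : P ⟶ Q) :
    (toTop G X).IsStronglyCartesian ((toTop G X).map φ) φ where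
  universal_property' {P'} g φ' hφ' := by
    have hb := IsHomLift.eq_of_isHomLift (toTop G X) (g ≫ (toTop G X).map φ) φ'
    obtain ⟨g, rfl⟩ : ∃ g' : P'.base ⟶ P.base, g' = g := ⟨g, rfl⟩
    replace hb : g ≫ φ.base = φ'.base := hb
    have hw : φ'.total ≫ Q.proj = (P'.proj ≫ g) ≫ φ.base := by
      rw [φ'.isPullback.w, Category.assoc, hb]
    let t : P'.total ⟶ P.total := φ.isPullback.lift φ'.total (P'.proj ≫ g) hw
    have ht₁ : ∀ e, φ.total (t e) = φ'.total e :=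
      ConcreteCategory.congr_hom (φ.isPullback.lift_fst _ _ hw)
    have ht₂ : ∀ e, P.proj (t e) = g (P'.proj e) :=
      ConcreteCategory.congr_hom (φ.isPullback.lift_snd _ _ hw)
    have hsmul : ∀ (k : G) (e : P'.total), t (op k • e) = op k • t e := by
      intro k e
      refine Hom.total_inj φ ?_ ?_
      · rw [ht₂, P.proj_smul, ht₂, P'.proj_smul]
      · rw [ht₁, φ.map_smul, ht₁, φ'.map_smul]
    let χ : P' ⟶ P :=
      { base := g
        total := t
        isPullback := isPullback_of_equivariant ht₂ hsmul
        map_smul := hsmul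
        toSpace_comp := fun e => by rw [← φ.toSpace_comp, ht₁, φ'.toSpace_comp] }
    refine ⟨χ, ⟨?_, Hom.ext hb (φ.isPullback.lift_fst _ _ hw)⟩, ?_⟩
    · exact IsHomLift.map (toTop G X) χ
    · rintro ψ ⟨hψ, hψφ⟩
      have hψb : g = ψ.base := IsHomLift.eq_of_isHomLift (toTop G X) _ ψ
      refine Hom.ext hψb.symm ?_
      refine φ.isPullback.hom_ext ?_ ?_
      · exact (congrArg Hom.total hψφ).trans (φ.isPullback.lift_fst _ _ hw).symm
      · refine Eq.trans ?_ (φ.isPullback.lift_snd _ _ hw).symm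
        rw [ψ.isPullback.w, hψb]

section Pullback

variable (P : QuotientStack.{u} G X) {S : TopCat.{u}} (f : S ⟶ P.base)

/-- The total space of the pullback of a principal bundle. -/
abbrev PullbackSpace : Type u := {q : S × P.total // f q.1 = P.proj q.2}

instance : MulAction Gᵐᵒᵖ (P.PullbackSpace f) where
  smul g q := ⟨(q.1.1, g • q.1.2), q.2.trans (P.proj_smul g.unop q.1.2).symm⟩
  one_smul _ := Subtype.ext (Prod.ext rfl (one_smul _ _))
  mul_smul g h _ := Subtype.ext (Prod.ext rfl (mul_smul g h _))

instance : ContinuousSMul Gᵐᵒᵖ (P.PullbackSpace f) where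
  continuous_smul := by
    refine Continuous.subtype_mk ?_ _
    have h : Continuous fun q : Gᵐᵒᵖ × P.PullbackSpace f => q.2.1 :=
      continuous_subtype_val.comp continuous_snd
    exact (continuous_fst.comp h).prodMk (continuous_fst.smul (continuous_snd.comp h))

theorem isProperMap_pullback [CompactSpace G] : IsProperMap fun q : P.PullbackSpace f => q.1.1 := by
  have hfst : Continuous fun q : P.PullbackSpace f => q.1.1 :=
    continuous_fst.comp continuous_subtype_val
  refine isProperMap_iff_ultrafilter.2 ⟨hfst, fun 𝒰 s h𝒰 => ?_⟩
  have h1 : Tendsto (fun q : P.PullbackSpace f => P.proj q.1.2) 𝒰 (𝓝 (f s)) :=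
    ((f.hom.continuous.tendsto s).comp h𝒰).congr fun q => q.2
  obtain ⟨e, he, hte⟩ := P.isProperMap_proj.exists_tendsto h1
  refine ⟨⟨(s, e), he.symm⟩, rfl, ?_⟩
  have : Tendsto (fun q : P.PullbackSpace f => q) 𝒰 (𝓝 ⟨(s, e), he.symm⟩) :=
    tendsto_subtype_rng.2 (h𝒰.prodMk_nhds hte)
  exact this

theorem isSeparatedMap_pullback [T2Space G] : IsSeparatedMap fun q : P.PullbackSpace f => q.1.1 := by
  refine isSeparatedMap_of_ultrafilter fun 𝒰 q r hqr hq hr => ?_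
  have hsnd : Continuous fun q : P.PullbackSpace f => q.1.2 :=
    continuous_snd.comp continuous_subtype_val
  refine Subtype.ext (Prod.ext hqr ?_)
  refine P.isSeparatedMap_proj.eq_of_ultrafilter_le
    (𝒰 := 𝒰.map fun q : P.PullbackSpace f => q.1.2) ?_
    ((hsnd.tendsto q).mono_left hq) ((hsnd.tendsto r).mono_left hr)
  rw [← q.2, ← r.2]
  exact congrArg f hqr

variable [DiscreteTopology G] [Finite G]

/-- The pullback of a principal bundle with a map to `X`. -/
def pullback : QuotientStack.{u} G X where
  base := S
  total := TopCat.of (P.PullbackSpace f)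
  proj := TopCat.ofHom ⟨fun q : P.PullbackSpace f => q.1.1,
    continuous_fst.comp continuous_subtype_val⟩
  mulAction := inferInstanceAs (MulAction _ (P.PullbackSpace f))
  continuousSMul := inferInstanceAs (ContinuousSMul _ (P.PullbackSpace f))
  proj_smul _ _ := rfl
  locallyTrivial s := exists_equivariant_trivialization (E := P.PullbackSpace f)
    (P.isProperMap_pullback f) (P.isSeparatedMap_pullback f)
    (fun s => by
      obtain ⟨e, he⟩ := P.proj_surjective (f s)
      exact ⟨⟨(s, e), he.symm⟩, rfl⟩)
    (fun _ _ => rfl)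
    (fun q r h => by
      have h' : f q.1.1 = f r.1.1 := congrArg f h
      obtain ⟨g, hg⟩ := P.exists_op_smul_eq (q.2.symm.trans (h'.trans r.2))
      exact ⟨g, Subtype.ext (Prod.ext h hg)⟩)
    (fun q g h => P.eq_one_of_op_smul_eq
      (congrArg (fun r : P.PullbackSpace f => r.1.2) h)) s
  toSpace := P.toSpace.comp ⟨fun q : P.PullbackSpace f => q.1.2,
    continuous_snd.comp continuous_subtype_val⟩
  toSpace_smul g q := P.toSpace_smul g q.1.2

/-- The canonical map from the pullback. -/
def pullbackMap : P.pullback f ⟶ P :=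
  let t : (P.pullback f).total ⟶ P.total := TopCat.ofHom ⟨fun q : P.PullbackSpace f => q.1.2,
    continuous_snd.comp continuous_subtype_val⟩
  { base := f
    total := t
    isPullback := isPullback_of_equivariant (P := P.pullback f) (t := t)
      (fun q : P.PullbackSpace f => q.2.symm) (fun _ _ => rfl)
    map_smul := fun _ _ => rfl
    toSpace_comp := fun _ => rfl }

end Pullback

variable [DiscreteTopology G] [Finite G]

theorem isGroupoidFibration_toTop : IsGroupoidFibration (toTop.{u} G X) :=
  isGroupoidFibration_of_isStronglyCartesian
    (fun P _ f => ⟨P.pullback f, P.pullbackMap f, IsHomLift.map (toTop G X) (P.pullbackMap f)⟩)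
    isStronglyCartesian

theorem isIso_of_isIso_base {P Q : QuotientStack.{u} G X} (φ : P ⟶ Q) [IsIso φ.base] : IsIso φ := by
  have := isStronglyCartesian φ
  have : IsIso ((toTop G X).map φ) := ‹IsIso φ.base›
  exact Functor.IsStronglyCartesian.isIso_of_base_isIso (toTop G X) ((toTop G X).map φ) φ

end QuotientStack

/-! ### The family of triangles associated to a principal bundle -/

namespace QuotientStack

open MulOpposite BarySimplex OrientedModuli

variable (P : QuotientStack.{u} (Equiv.Perm (Fin 3)) OrientedModuli)

/-- The equivalence relation on `E × Δ²` that identifies `(e · σ, s)` with `(e, σ · s)`. -/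
def assocSetoid : Setoid (P.total × BarySimplex) where
  r q r := ∃ σ : Equiv.Perm (Fin 3), r.1 = op σ • q.1 ∧ q.2 = σ • r.2
  iseqv :=
    { refl := fun q => ⟨1, (one_smul _ _).symm, (one_smul _ _).symm⟩
      symm := by
        rintro q r ⟨σ, h₁, h₂⟩
        refine ⟨σ⁻¹, ?_, ?_⟩
        · rw [h₁, ← mul_smul, ← op_mul, mul_inv_cancel, op_one, one_smul]
        · rw [h₂, inv_smul_smul]
      trans := by
        rintro q r _ ⟨σ, h₁, h₂⟩ ⟨τ, h₃, h₄⟩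
        exact ⟨σ * τ, by rw [h₃, h₁, op_mul, mul_smul], by rw [h₂, h₄, mul_smul]⟩ }

/-- The total space of the bundle of triangles associated to a principal bundle. -/
def AssocSpace : Type u := Quotient P.assocSetoid

instance : TopologicalSpace P.AssocSpace :=
  inferInstanceAs (TopologicalSpace (Quotient P.assocSetoid))

/-- The class of a point of `E × Δ²`. -/
def assocMk (e : P.total) (s : BarySimplex) : P.AssocSpace :=
  Quotient.mk P.assocSetoid (e, s)

theorem isQuotientMap_assocMk :
    IsQuotientMap fun q : P.total × BarySimplex => P.assocMk q.1 q.2 :=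
  isQuotientMap_quot_mk

theorem assocMk_smul (σ : Equiv.Perm (Fin 3)) (e : P.total) (s : BarySimplex) :
    P.assocMk (op σ • e) s = P.assocMk e (σ • s) :=
  (Quotient.sound (s := P.assocSetoid) ⟨σ, rfl, rfl⟩).symm

theorem exists_of_assocMk_eq {e e' : P.total} {s s' : BarySimplex}
    (h : P.assocMk e s = P.assocMk e' s') :
    ∃ σ : Equiv.Perm (Fin 3), e' = op σ • e ∧ s = σ • s' :=
  Quotient.exact h

theorem assocMk_injective (e : P.total) : Function.Injective (P.assocMk e) := by
  intro s t h
  obtain ⟨σ, he, rfl⟩ := P.exists_of_assocMk_eq h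
  rw [P.eq_one_of_op_smul_eq he.symm, one_smul]

/-- The projection of the associated bundle. -/
def assocProj : P.AssocSpace → P.base :=
  Quotient.lift (fun q : P.total × BarySimplex => P.proj q.1) (by
    rintro q r ⟨σ, h, -⟩
    rw [h, P.proj_smul])

theorem assocProj_mk (e : P.total) (s : BarySimplex) :
    P.assocProj (P.assocMk e s) = P.proj e := rfl

theorem continuous_assocProj : Continuous P.assocProj :=
  P.isQuotientMap_assocMk.continuous_iff.2 (P.proj.hom.continuous.comp continuous_fst)

theorem exists_assocMk (a : P.AssocSpace) : ∃ e s, P.assocMk e s = a := by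
  obtain ⟨⟨e, s⟩, h⟩ := P.isQuotientMap_assocMk.surjective a
  exact ⟨e, s, h⟩

theorem exists_assocMk_eq {e : P.total} {a : P.AssocSpace} (h : P.assocProj a = P.proj e) :
    ∃ s, P.assocMk e s = a := by
  obtain ⟨e', s, rfl⟩ := P.exists_assocMk a
  obtain ⟨σ, rfl⟩ := P.exists_op_smul_eq (e := e) (e' := e') h.symm
  exact ⟨_, (P.assocMk_smul σ e s).symm⟩

/-- An equivariant trivialization of a principal bundle trivializes the associated bundle. -/
theorem exists_assocTrivialization (t : Trivialization (Equiv.Perm (Fin 3)) P.proj)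
    (ht : ∀ e ∈ t.source, ∀ g : Equiv.Perm (Fin 3), (t (op g • e)).2 = (t e).2 * g) :
    ∃ T : Trivialization (ULift.{u} BarySimplex) P.assocProj, T.baseSet = t.baseSet ∧
      ∀ a ∈ T.source, P.assocMk (t.toPartialEquiv.symm (P.assocProj a, 1)) (T a).2.down = a := by
  choose e s hes using P.exists_assocMk
  let f : P.AssocSpace → P.base × ULift.{u} BarySimplex := fun a =>
    (P.assocProj a, ULift.up ((t (e a)).2 • s a))
  -- Independence of the representative: passing from `e` to `e · σ` multiplies the group coordinate
  -- by `σ` on the right, which cancels against the change in the simplex.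
  have hf : ∀ e' s', P.proj e' ∈ t.baseSet →
      f (P.assocMk e' s') = (P.proj e', ULift.up ((t e').2 • s')) := by
    intro e' s' he'
    refine Prod.ext rfl (congrArg ULift.up ?_)
    obtain ⟨σ, h1, h2⟩ := P.exists_of_assocMk_eq (hes (P.assocMk e' s'))
    have hsrc : e (P.assocMk e' s') ∈ t.source := by
      refine t.mem_source.2 ?_
      rw [← P.proj_smul σ, ← h1]
      exact he'
    change (t (e (P.assocMk e' s'))).2 • s (P.assocMk e' s') = (t e').2 • s'
    rw [h2, smul_smul, ← ht _ hsrc, ← h1]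
  have hσ : ∀ y ∈ t.baseSet, (t (t.toPartialEquiv.symm (y, 1))) = (y, 1) := fun y hy =>
    t.apply_symm_apply' hy
  have hσp : ∀ y ∈ t.baseSet, P.proj (t.toPartialEquiv.symm (y, 1)) = y := fun y hy =>
    t.proj_symm_apply' hy
  have hleft : ∀ a, P.assocProj a ∈ t.baseSet →
      P.assocMk (t.toPartialEquiv.symm (P.assocProj a, 1)) (f a).2.down = a := by
    intro a ha
    have hp := hσp _ ha
    obtain ⟨s', hs'⟩ := P.exists_assocMk_eq (a := a) hp.symm
    have h := hf (t.toPartialEquiv.symm (P.assocProj a, 1)) s' (by rw [hp]; exact ha)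
    rw [hs', hσ _ ha, one_smul] at h
    rw [h, hs']
  refine ⟨
    { toFun := f
      invFun := fun q => P.assocMk (t.toPartialEquiv.symm (q.1, 1)) q.2.down
      source := P.assocProj ⁻¹' t.baseSet
      target := t.baseSet ×ˢ Set.univ
      map_source' := fun a ha => ⟨ha, trivial⟩
      map_target' := fun q hq => by
        change P.proj _ ∈ t.baseSet
        rw [hσp _ hq.1]
        exact hq.1
      left_inv' := hleft
      right_inv' := fun q hq => by
        have hp := hσp _ hq.1
        refine (hf _ _ (by rw [hp]; exact hq.1)).trans ?_
        rw [hσ _ hq.1, hp, one_smul]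
      open_source := t.open_baseSet.preimage P.continuous_assocProj
      open_target := t.open_baseSet.prod isOpen_univ
      continuousOn_toFun := by
        rw [P.isQuotientMap_assocMk.continuousOn_isOpen_iff
          (t.open_baseSet.preimage P.continuous_assocProj)]
        have hc : ContinuousOn (fun q : P.total × BarySimplex =>
            (P.proj q.1, ULift.up.{u} ((t q.1).2 • q.2)))
            ((fun q : P.total × BarySimplex => P.assocMk q.1 q.2) ⁻¹'
              (P.assocProj ⁻¹' t.baseSet)) := by
          refine (P.proj.hom.continuous.comp continuous_fst).continuousOn.prodMk ?_
          refine continuous_uliftUp.comp_continuousOn ?_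
          have ht' : ContinuousOn (fun q : P.total × BarySimplex => t q.1)
              ((fun q : P.total × BarySimplex => P.assocMk q.1 q.2) ⁻¹'
                (P.assocProj ⁻¹' t.baseSet)) :=
            t.continuousOn_toFun.comp continuous_fst.continuousOn fun q hq => t.mem_source.2 hq
          have hsnd : Continuous fun q : P.total × BarySimplex => q.2 := continuous_snd
          exact (continuous_snd.comp_continuousOn ht').smul hsnd.continuousOn
        exact hc.congr fun q hq => hf q.1 q.2 hq
      continuousOn_invFun := by
        refine P.isQuotientMap_assocMk.continuous.comp_continuousOn
          (f := fun q : P.base × ULift.{u} BarySimplex =>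
            (t.toPartialEquiv.symm (q.1, 1), q.2.down)) ?_
        refine ContinuousOn.prodMk ?_ (continuous_uliftDown.comp continuous_snd).continuousOn
        refine t.continuousOn_invFun.comp
          (f := fun q : P.base × ULift.{u} BarySimplex => (q.1, (1 : Equiv.Perm (Fin 3))))
          (continuous_fst.prodMk continuous_const).continuousOn fun q hq => t.mem_target.2 hq.1
      baseSet := t.baseSet
      open_baseSet := t.open_baseSet
      source_eq := rfl
      target_eq := rfl
      proj_toFun := fun _ _ => rfl }, rfl, fun a ha => hleft a ha⟩

/-- The pairs of points in the same fiber of the associated bundle. -/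
abbrev AssocPairs : Type u :=
  {q : P.AssocSpace × P.AssocSpace // P.assocProj q.1 = P.assocProj q.2}

theorem exists_assocMk_pair (q : P.AssocPairs) :
    ∃ (e : P.total) (s t : BarySimplex), P.assocMk e s = q.1.1 ∧ P.assocMk e t = q.1.2 := by
  obtain ⟨e, s, h⟩ := P.exists_assocMk q.1.1
  obtain ⟨t, ht⟩ := P.exists_assocMk_eq (e := e) (a := q.1.2)
    (by rw [← q.2, ← h, P.assocProj_mk])
  exact ⟨e, s, t, h, ht⟩

/-- The distance on the associated bundle. -/
noncomputable def assocDist (q : P.AssocPairs) : ℝ :=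
  √(sqDist (P.toSpace (P.exists_assocMk_pair q).choose)
    (P.exists_assocMk_pair q).choose_spec.choose
    (P.exists_assocMk_pair q).choose_spec.choose_spec.choose)

/-- Any representatives over a common `e` may be used: changing `e` relabels the edge lengths and
both coordinate vectors simultaneously, and `sqDist_smul` applies. -/
theorem assocDist_eq {q : P.AssocPairs} {e : P.total} {s t : BarySimplex}
    (hs : P.assocMk e s = q.1.1) (ht : P.assocMk e t = q.1.2) :
    P.assocDist q = √(sqDist (P.toSpace e) s t) := by
  obtain ⟨hs', ht'⟩ := (P.exists_assocMk_pair q).choose_spec.choose_spec.choose_spec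
  unfold assocDist
  generalize (P.exists_assocMk_pair q).choose_spec.choose_spec.choose = t' at *
  generalize (P.exists_assocMk_pair q).choose_spec.choose = s' at *
  generalize (P.exists_assocMk_pair q).choose = e' at *
  obtain ⟨σ, rfl, rfl⟩ := P.exists_of_assocMk_eq (hs.trans hs'.symm)
  rw [P.assocMk_smul] at ht'
  obtain rfl := P.assocMk_injective e (ht'.trans ht.symm)
  rw [P.toSpace_smul, ← sqDist_smul σ, smul_inv_smul]

theorem continuous_assocDist : Continuous P.assocDist := by
  rw [continuous_iff_continuousAt]
  intro q₀
  obtain ⟨t, hy, ht⟩ := P.locallyTrivial (P.assocProj q₀.1.1)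
  obtain ⟨T, hTt, hT⟩ := P.exists_assocTrivialization t ht
  have hfst : Continuous fun q : P.AssocPairs => q.1.1 := continuous_fst.comp continuous_subtype_val
  have hsnd : Continuous fun q : P.AssocPairs => q.1.2 := continuous_snd.comp continuous_subtype_val
  have hpr := P.continuous_assocProj.comp hfst
  have hmem : ∀ q : P.AssocPairs,
      P.assocProj q.1.1 ∈ t.baseSet → q.1.1 ∈ T.source ∧ q.1.2 ∈ T.source := fun q hq =>
    ⟨T.mem_source.2 (hTt ▸ hq), T.mem_source.2 (hTt ▸ q.2 ▸ hq)⟩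
  -- The local unit section of the principal bundle replaces the arbitrary choice of representative
  -- by a continuous one.
  have hcont : ContinuousAt (fun q : P.AssocPairs =>
      √(sqDist (P.toSpace (t.toOpenPartialHomeomorph.symm (P.assocProj q.1.1, 1)))
        (T q.1.1).2.down (T q.1.2).2.down)) q₀ := by
    have h1 : ContinuousAt (fun q : P.AssocPairs =>
        t.toOpenPartialHomeomorph.symm (P.assocProj q.1.1, 1)) q₀ :=
      ContinuousAt.comp (f := fun q : P.AssocPairs => (P.assocProj q.1.1, (1 : Equiv.Perm (Fin 3))))
        (t.toOpenPartialHomeomorph.continuousAt_symm (t.mem_target.2 hy))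
        (hpr.prodMk continuous_const).continuousAt
    have h2 : ContinuousAt (fun q : P.AssocPairs => (T q.1.1).2.down) q₀ :=
      (continuous_uliftDown.comp continuous_snd).continuousAt.comp
        (ContinuousAt.comp (f := fun q : P.AssocPairs => q.1.1)
          (T.continuousAt (hmem q₀ hy).1) hfst.continuousAt)
    have h3 : ContinuousAt (fun q : P.AssocPairs => (T q.1.2).2.down) q₀ :=
      (continuous_uliftDown.comp continuous_snd).continuousAt.comp
        (ContinuousAt.comp (f := fun q : P.AssocPairs => q.1.2)
          (T.continuousAt (hmem q₀ hy).2) hsnd.continuousAt)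
    exact continuousAt_sqrt_sqDist (P.toSpace.continuous.continuousAt.comp h1) h2 h3
  refine hcont.congr ?_
  filter_upwards [hpr.continuousAt.eventually (t.open_baseSet.mem_nhds hy)] with q hq
  refine (P.assocDist_eq (hT q.1.1 (hmem q hq).1) ?_).symm
  have h := hT q.1.2 (hmem q hq).2
  rwa [← q.2] at h

/-- The family of triangles associated to a principal bundle with a map to the moduli space of
oriented triangles. -/
noncomputable def assocFamily : TriangleFamily.{u} where
  base := P.base
  total := TopCat.of P.AssocSpace
  proj := TopCat.ofHom ⟨P.assocProj, P.continuous_assocProj⟩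
  isProper := isProperMap_of_trivialization P.continuous_assocProj fun y => by
    obtain ⟨t, hy, ht⟩ := P.locallyTrivial y
    obtain ⟨T, hTt, -⟩ := P.exists_assocTrivialization t ht
    exact ⟨T, hTt ▸ hy⟩
  isFiberBundle := ⟨ULift.{u} BarySimplex, inferInstance, fun y => by
    obtain ⟨t, hy, ht⟩ := P.locallyTrivial y
    obtain ⟨T, hTt, -⟩ := P.exists_assocTrivialization t ht
    exact ⟨T, hTt ▸ hy⟩⟩
  dist := P.assocDist
  continuous_dist := P.continuous_assocDist
  isTriangle y := by
    obtain ⟨e, rfl⟩ := P.proj_surjective y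
    obtain ⟨Δ, hΔ⟩ := exists_ofTriangle (P.toSpace e)
    let φ : BarySimplex ≃ {a : P.AssocSpace // P.assocProj a = P.proj e} :=
      Equiv.ofBijective (fun s => ⟨P.assocMk e s, rfl⟩)
        ⟨fun s t h => P.assocMk_injective e (congrArg Subtype.val h), fun a => by
          obtain ⟨s, hs⟩ := P.exists_assocMk_eq a.2
          exact ⟨s, Subtype.ext hs⟩⟩
    refine ⟨Δ, φ.symm.trans (equivClosedInterior Δ), fun a b => ?_⟩
    obtain ⟨s, rfl⟩ := φ.surjective a
    obtain ⟨t, rfl⟩ := φ.surjective b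
    refine (P.assocDist_eq (e := e) (s := s) (t := t) rfl rfl).trans ?_
    simp only [Equiv.trans_apply, Equiv.symm_apply_apply]
    rw [dist_equivClosedInterior, hΔ]

theorem isChart_assocMk (e : P.total) :
    P.assocFamily.IsChart (P.proj e) (P.toSpace e) (P.assocMk e) where
  proj_eq _ := rfl
  exists_eq _ ha := P.exists_assocMk_eq ha
  fdist_eq s t := by
    rw [TriangleFamily.fdist_eq (F := P.assocFamily) (a := P.assocMk e s) (b := P.assocMk e t) rfl]
    exact P.assocDist_eq rfl rfl

/-- A point of the principal bundle labels the vertices of the associated family. -/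
noncomputable def toVertexSpace (e : P.total) : P.assocFamily.VertexSpace :=
  ⟨fun i => P.assocMk e (vertex i), (P.isChart_assocMk e).isVertices⟩

theorem continuous_toVertexSpace : Continuous P.toVertexSpace :=
  Continuous.subtype_mk (continuous_pi fun _ =>
    P.isQuotientMap_assocMk.continuous.comp (continuous_id.prodMk continuous_const)) _

theorem toVertexSpace_smul (σ : Equiv.Perm (Fin 3)) (e : P.total) :
    P.toVertexSpace (op σ • e) = op σ • P.toVertexSpace e := by
  refine Subtype.ext (funext fun i => ?_)
  change P.assocMk (op σ • e) (vertex i) = P.assocMk e (vertex (σ i))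
  rw [P.assocMk_smul, smul_vertex]

/-- A principal bundle maps to the bundle of vertices of the associated family. -/
noncomputable def toVertexBundle : P ⟶ P.assocFamily.vertexBundle :=
  let t : P.total ⟶ P.assocFamily.vertexBundle.total :=
    TopCat.ofHom ⟨P.toVertexSpace, P.continuous_toVertexSpace⟩
  { base := 𝟙 P.base
    total := t
    isPullback := isPullback_of_equivariant (Q := P.assocFamily.vertexBundle) (t := t)
      (fun _ => rfl) P.toVertexSpace_smul
    map_smul := P.toVertexSpace_smul
    toSpace_comp := fun e => (P.isChart_assocMk e).edges_eq _ fun _ => rfl }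

/-- All morphisms of the quotient stack are strongly cartesian, so one over an identity is
invertible; no inverse has to be constructed. -/
instance : IsIso P.toVertexBundle :=
  have : IsIso P.toVertexBundle.base := inferInstanceAs (IsIso (𝟙 P.base))
  isIso_of_isIso_base _

theorem exists_vertexBundle_iso :
    ∃ (F : TriangleFamily.{u}) (e : F.vertexBundle ≅ P),
      (toTop _ _).IsHomLift (𝟙 P.base) e.hom := by
  refine ⟨P.assocFamily, (asIso P.toVertexBundle).symm, ?_⟩
  have h : (toTop _ _).IsHomLift (𝟙 P.base) (asIso P.toVertexBundle).hom :=
    IsHomLift.map (toTop _ _) P.toVertexBundle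
  exact IsHomLift.lift_id_inv (toTop _ _) P.base (asIso P.toVertexBundle)

end QuotientStack

/-! ### The equivalence between families of triangles and the quotient stack -/

instance : TriangleFamily.vertexBasedFunctor.{u}.toFunctor.Full :=
  inferInstanceAs TriangleFamily.vertexFunctor.{u}.Full

instance : TriangleFamily.vertexBasedFunctor.{u}.toFunctor.Faithful :=
  inferInstanceAs TriangleFamily.vertexFunctor.{u}.Faithful

/-- The families of triangles form a category fibered in groupoids over `Top`, so does the quotient
stack `[M/S₃]`, and the two are equivalent over `Top`: there are functors in both directions that
commute with the projections to `Top` and are mutually inverse up to natural isomorphisms lying over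
identities. -/
theorem theorem2p15 :
    IsGroupoidFibration triangleFamilies.{u}.p ∧
    IsGroupoidFibration (quotientStack.{u} (Equiv.Perm (Fin 3)) OrientedModuli).p ∧
    Nonempty (Bicategory.Equivalence triangleFamilies.{u}
      (quotientStack.{u} (Equiv.Perm (Fin 3)) OrientedModuli)) := by
  have hQ : IsGroupoidFibration (quotientStack.{u} (Equiv.Perm (Fin 3)) OrientedModuli).p :=
    QuotientStack.isGroupoidFibration_toTop
  exact ⟨TriangleFamily.vertexBasedFunctor.isGroupoidFibration_of_fullyFaithful
    QuotientStack.exists_vertexBundle_iso hQ, hQ,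
    TriangleFamily.vertexBasedFunctor.nonempty_equivalence
      QuotientStack.exists_vertexBundle_iso⟩
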